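/- Let $n,r,d$ be non-negative integers, put $m=rn$, and let $U=\{u_1<\dots<u_n\}$ and $V=\{v_1<\dots<v_n\}$ be disjoint totally ordered sets of size $n$. A bipartite multigraph $G$ on $U,V$ is given by edge multiplicities $\mu(u,v)\in\mathbb{Z}_{\ge 0}$; it is $r$-regular if $\sum_{v}\mu(u,v)=r$ for every $u\in U$ and $\sum_{u}\mu(u,v)=r$ for every $v\in V$. A planar matching of $G$ is a set of edges of $G$ any two distinct ones of which, $uv$ and $u'v'$, satisfy either $u<u'$ and $v<v'$, or $u'<u$ and $v'<v$. An $r$-configuration of $U$ and $V$ is a bijection (perfect pairing) between $U\times[r]$ and $V\times[r]$; write $u^i=(u,i)$ and $v^j=(v,j)$. The configuration $\overline{G}$ associated to an $r$-regular $G$ consists of the following pairings: for each $(u,v)$ with $t=\mu(u,v)$, $i=\sum_{v'>v}\mu(u,v')$ and $j=\sum_{u'>u}\mu(u',v)$, the pairs $(u^{i+s},v^{j+t-s+1})$ with $1\le s\le t$. Let $\overline{G}_r(U,V;d)$ be the set of the configurations $\overline{G}$ associated to the $r$-regular bipartite multigraphs $G$ on $U,V$ all of whose planar matchings have at most $d$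 edges. For $a_1,\dots,a_m,b_1,\dots,b_m\in[d]$, let $a_1\cdots a_m|b_1\cdots b_m$ denote the lattice walk of length $2m$ in $\mathbb{Z}^d$ that starts at the origin and makes the positive unit steps $+\vec e_{a_1},\dots,+\vec e_{a_m}$ followed by the negative unit steps $-\vec e_{b_1},\dots,-\vec e_{b_m}$. Let $W'(d,2m;\vec 0)$ be the set of those walks of this form that end at the origin and for which both sequences are weakly decreasing on each of the $n$ consecutive blocks of length $r$, that is, $a_{r(k-1)+i}\ge a_{r(k-1)+i+1}$ and $b_{r(k-1)+i}\ge b_{r(k-1)+i+1}$ for $1\le k\le n$ and $1\le i<r$. Let $\widetilde W(d,2m;\vec 0)$ be the set of the walks $a_1\cdots a_m|b_m\cdots b_1$ with $a_1\cdots a_m|b_1\cdots b_m\in W'(d,2m;\vec 0)$. **Theorem 6.** There is a bijection between $\overline{G}_r(U,V;d)$ and the set of the walks in $\widetilde W(d,2rn;\vec 0)$ all of whose $2rn+1$ points lie in the region $x_1\ge x_2\ge\dots\ge x_d$. -/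

import Mathlib

namespace PlanarMatching

section Graphs

variable {U V : Type*} [LinearOrder U] [LinearOrder V]

/-- A bipartite multi-graph with color classes `U` and `V`, given by its adjacency matrix:
`mult u v` is the multiplicity of the edge `uv`. -/
@[ext]
structure BipMultigraph (U V : Type*) where
  /-- The number of parallel edges joining `u` and `v`. -/
  mult : U → V → ℕ

/-- Every vertex of `U` and every vertex of `V` has degree `r`, counted with multiplicity. -/
def BipMultigraph.IsRegular [Fintype U] [Fintype V] (G : BipMultigraph U V) (r : ℕ) : Prop :=
  (∀ u, ∑ v, G.mult u v = r) ∧ ∀ v, ∑ u, G.mult u v = r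

/-- Two edges `uv` and `u'v'` are noncrossing if `u, u'` are in the same strict order
as `v, v'`. -/
def Noncrossing (e f : U × V) : Prop :=
  (e.1 < f.1 ∧ e.2 < f.2) ∨ (f.1 < e.1 ∧ f.2 < e.2)

/-- `M` is a planar matching of `G`: a set of edges of `G`, no two of which share an endpoint
(in particular at most one of several parallel edges is used, so that a set of pairs
describes it), such that any two distinct ones are noncrossing. -/
structure IsPlanarMatching (G : BipMultigraph U V) (M : Finset (U × V)) : Prop where
  isEdge : ∀ e ∈ M, 0 < G.mult e.1 e.2
  disjoint : ∀ e ∈ M, ∀ f ∈ M, e ≠ f → e.1 ≠ f.1 ∧ e.2 ≠ f.2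
  noncrossing : ∀ e ∈ M, ∀ f ∈ M, e ≠ f → Noncrossing e f

open Classical in
/-- `L(G)`: the number of edges of a largest planar matching of `G`. -/
noncomputable def largestPlanar [Fintype U] [Fintype V] (G : BipMultigraph U V) : ℕ :=
  (Finset.univ.filter fun M : Finset (U × V) => IsPlanarMatching G M).sup Finset.card

/-- The `r`-regular bipartite multi-graphs on `U` and `V` whose largest planar matching is of
size at most `d`. -/
def regularGraphs (U V : Type*) [LinearOrder U] [LinearOrder V] [Fintype U] [Fintype V]
    (r d : ℕ) : Set (BipMultigraph U V) :=
  {G | G.IsRegular r ∧ largestPlanar G ≤ d}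

/-- An `r`-configuration of `U` and `V`: a one-to-one pairing of `U × [r]` and `V × [r]`. -/
abbrev Configuration (U V : Type*) (r : ℕ) : Type _ := (U × Fin r) ≃ (V × Fin r)

/-- The pairing of `x = u^k` and `y = v^l` belongs to the configuration associated to `G`.
With `t` the multiplicity of `uv`, `i` the number of edges `uv'` with `v < v'` and `j` the number
of edges `u'v` with `u < u'`, the pairings between copies of `u` and of `v` are
`(u^(i+s), v^(j+t-s+1))` for `1 ≤ s ≤ t`. Copies are numbered from `0` in Lean, hence the `+ 1`s. -/
def BarEdge [Fintype U] [Fintype V] {r : ℕ} (G : BipMultigraph U V)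
    (x : U × Fin r) (y : V × Fin r) : Prop :=
  ∃ s : ℕ, 1 ≤ s ∧ s ≤ G.mult x.1 y.1 ∧
    (x.2 : ℕ) + 1 = (∑ v ∈ Finset.univ.filter (fun v => y.1 < v), G.mult x.1 v) + s ∧
    (y.2 : ℕ) + 1 =
      (∑ u ∈ Finset.univ.filter (fun u => x.1 < u), G.mult u y.1) + (G.mult x.1 y.1 - s) + 1

/-- The configuration `F` is the one associated to the multi-graph `G`. -/
def IsAssociated [Fintype U] [Fintype V] {r : ℕ} (G : BipMultigraph U V)
    (F : Configuration U V r) : Prop :=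
  ∀ x y, F x = y ↔ BarEdge G x y

/-- The configurations associated to the `r`-regular bipartite multi-graphs on `U` and `V` whose
largest planar matching is of size at most `d`. -/
def regularConfigurations (U V : Type*) [LinearOrder U] [LinearOrder V] [Fintype U] [Fintype V]
    (r d : ℕ) : Set (Configuration U V r) :=
  {F | ∃ G ∈ regularGraphs U V r d, IsAssociated G F}

end Graphs

section Walks

/-- `W(d, N; p)`: the lattice walks `w_0 ⋯ w_N` in `ℤ^d` from the origin to `p`. -/
def walks (d N : ℕ) (p : Fin d → ℤ) : Set (Fin (N + 1) → Fin d → ℤ) :=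
  {w | (∀ i : Fin N, ∑ k, |w i.succ k - w i.castSucc k| = 1) ∧ w 0 = 0 ∧ w (Fin.last N) = p}

/-- The walk `w` is written `a_1 ⋯ a_m | b_1 ⋯ b_m`: it makes positive steps in the directions
`a_1, …, a_m`, followed by negative steps in the directions `b_1, …, b_m`. -/
def HasSteps {d m : ℕ} (w : Fin (m + m + 1) → Fin d → ℤ) (a b : Fin m → Fin d) : Prop :=
  (∀ i : Fin m, w (Fin.castAdd m i).succ = w (Fin.castAdd m i).castSucc + Pi.single (a i) 1) ∧
  ∀ j : Fin m, w (Fin.natAdd m j).succ = w (Fin.natAdd m j).castSucc - Pi.single (b j) 1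

/-- When `[nr]` is divided into `n` consecutive blocks of length `r`, the sequence `a` is weakly
decreasing on each block (`finProdFinEquiv (u, i) = r * u + i`). -/
def BlockDecreasing {d n r : ℕ} (a : Fin (n * r) → Fin d) : Prop :=
  ∀ (u : Fin n) (i : Fin r) (h : (i : ℕ) + 1 < r),
    a (finProdFinEquiv (u, i)) ≥ a (finProdFinEquiv (u, ⟨i + 1, h⟩))

/-- `W'(d, 2rn; p)`: the walks of length `2rn` from the origin to `p`, with `rn` positive steps
followed by `rn` negative steps, both sequences being weakly decreasing on blocks. -/
def blockWalks (d n r : ℕ) (p : Fin d → ℤ) : Set (Fin (n * r + n * r + 1) → Fin d → ℤ) :=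
  {w | w ∈ walks d (n * r + n * r) p ∧
    ∃ a b : Fin (n * r) → Fin d, HasSteps w a b ∧ BlockDecreasing a ∧ BlockDecreasing b}

/-- The walks obtained from those of `W'(d, 2rn; p)` by reversing the order of the negative
steps. -/
def reversedWalks (d n r : ℕ) (p : Fin d → ℤ) : Set (Fin (n * r + n * r + 1) → Fin d → ℤ) :=
  {w | w ∈ walks d (n * r + n * r) p ∧
    ∃ v ∈ blockWalks d n r p, ∃ a b : Fin (n * r) → Fin d,
      HasSteps v a b ∧ HasSteps w a (b ∘ Fin.rev)}

/-- The walk `w` stays in the region `x_1 ≥ x_2 ≥ ⋯ ≥ x_d`. -/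
def StaysInChamber {d N : ℕ} (w : Fin (N + 1) → Fin d → ℤ) : Prop :=
  ∀ t : Fin (N + 1), ∀ i j : Fin d, i ≤ j → w t i ≥ w t j

end Walks

end PlanarMatching

/-!
The configuration of a regular multigraph `G` determines `G`: the vertices `u` and `v` are joined
by as many edges as there are copies of `u` paired with copies of `v`. Conversely the pairings
prescribed by `G` do form a configuration, because the intervals of copies of a vertex `u` that
belong to its various neighbours partition `[r]`. So the configurations in question correspond to
the `n × n` matrices of natural numbers with all row and column sums `r` in which no `d + 1`
positive entries have strictly increasing row and column indices.

These matrices are mapped to pairs of semistandard tableaux by Burge's variant of the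
Robinson–Schensted–Knuth correspondence, in the form of growth diagrams. The vertices of the grid
carry partitions, empty on two adjacent sides, and each cell relates the partitions at its corners
and the matrix entry by the relation `LocalRule`. For given `β` and `γ` at two opposite corners, it
is a bijection between the pairs of a partition `α` at the third corner and an entry, and the
partitions `δ` at the fourth (`LocalRule.exists_of_corner`, `LocalRule.exists_of_opposite_corner`
and the two uniqueness lemmas). Hence the matrix determines the diagram, and so do the chains of
partitions along its two far sides, which are two tableaux of the same shape. Under the local rule
sizes are additive (`LocalRule.sum_add_sum`), so that row and column sums become the contents of
the tableaux. Moreover `δ` has a row beyond those of `β` and `γ` exactly when the entry is positive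
and `α` has all the preceding rows (`LocalRule.succ_pos_iff`). This is the recursion for the
longest chains of positive entries, so the number of rows of the final shape is the size
of a largest planar matching (`IsGrowth.pos_iff_hasChain`).

Finally, a tableau of content `(r, …, r)` with at most `d` rows is a word in the letters
`0, …, d - 1` that lists the rows of its entries in weakly increasing order of the entries, and
from the lowest row up for equal entries. Its blocks are weakly decreasing, and successive shapes
differ by horizontal strips exactly when all prefixes satisfy the chamber condition. A walk
`a_1 ⋯ a_m | b_m ⋯ b_1` that ends at the origin consists of the walk of `a` and the reversed walk
of `b`, so it stays in the chamber if and only if `a` and `b` are both such words.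
-/

namespace PlanarMatching

/-! ### Bijections given by relations -/

theorem exists_bijective_of_rel {A B : Type*} (S : Set A) (T : Set B) (R : A → B → Prop)
    (h1 : ∀ a ∈ S, ∃ b ∈ T, R a b) (h2 : ∀ b ∈ T, ∃ a ∈ S, R a b)
    (h3 : ∀ a ∈ S, ∀ b ∈ T, ∀ b' ∈ T, R a b → R a b' → b = b')
    (h4 : ∀ b ∈ T, ∀ a ∈ S, ∀ a' ∈ S, R a b → R a' b → a = a') :
    ∃ f : S → T, Function.Bijective f := by
  choose f hf using h1
  refine ⟨fun a => ⟨f a a.2, (hf a a.2).1⟩, fun a a' h => Subtype.ext ?_, fun b => ?_⟩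
  · have h' : f a a.2 = f a' a'.2 := congrArg Subtype.val h
    refine h4 _ (hf a a.2).1 a a.2 a' a'.2 (hf a a.2).2 ?_
    rw [h']
    exact (hf a' a'.2).2
  · obtain ⟨a, ha, hab⟩ := h2 b b.2
    exact ⟨⟨a, ha⟩, Subtype.ext (h3 a ha _ (hf a ha).1 b b.2 (hf a ha).2 hab)⟩

/-! ### The local rule -/

/-- The partition `β` arises from the partition `α` by adding a horizontal strip. Partitions are
sequences `ℕ → ℕ` of row lengths; the relation forces both sequences to be antitone. -/
def Interlace (α β : ℕ → ℕ) : Prop :=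
  ∀ i, α i ≤ β i ∧ β (i + 1) ≤ α i

/-- The row lengths vanish from some row on. -/
def FinitelyManyRows (α : ℕ → ℕ) : Prop :=
  ∃ N, ∀ i, N ≤ i → α i = 0

theorem Interlace.antitone_left {α β : ℕ → ℕ} (h : Interlace α β) : Antitone α :=
  antitone_nat_of_succ_le fun i => ((h (i + 1)).1).trans (h i).2

theorem Interlace.antitone_right {α β : ℕ → ℕ} (h : Interlace α β) : Antitone β :=
  antitone_nat_of_succ_le fun i => ((h i).2).trans (h i).1

theorem Interlace.finitelyManyRows {α β : ℕ → ℕ} (h : Interlace α β)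
    (hα : FinitelyManyRows α) : FinitelyManyRows β := by
  obtain ⟨N, hN⟩ := hα
  refine ⟨N + 1, fun i hi => ?_⟩
  obtain ⟨j, rfl⟩ : ∃ j, i = j + 1 := ⟨i - 1, by omega⟩
  have h1 := (h j).2
  have h2 := hN j (by omega)
  omega

theorem Interlace.finitelyManyRows' {α β : ℕ → ℕ} (h : Interlace α β)
    (hβ : FinitelyManyRows β) : FinitelyManyRows α := by
  obtain ⟨N, hN⟩ := hβ
  refine ⟨N, fun i hi => ?_⟩
  have h1 := (h i).1
  have h2 := hN i hi
  omega

/-- Burge's local rule for a cell with entry `c` whose corners carry the partitions `α` (both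
indices small), `β`, `γ` and `δ` (both indices large). The number `K i` is the carry that reaches
row `i` when the rows are treated from the last one up, starting with the carry `c`: row `i + 1`
absorbs as much of it as the condition `δ (i + 1) ≤ α i` permits, and the overlap
`min (β i) (γ i) - α i` of the two strips joins the carry for row `i`. The subtractions are
written as additions. -/
structure LocalRule (α β γ δ : ℕ → ℕ) (c : ℕ) : Prop where
  left : Interlace α β
  bottom : Interlace α γ
  top : Interlace β δ
  right : Interlace γ δ
  carry : ∃ K : ℕ → ℕ, (∃ N, ∀ i, N ≤ i → K i = c) ∧ δ 0 = max (β 0) (γ 0) + K 0 ∧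
    ∀ i, δ (i + 1) = min (max (β (i + 1)) (γ (i + 1)) + K (i + 1)) (α i) ∧
      K i + δ (i + 1) + α i =
        K (i + 1) + min (β i) (γ i) + max (β (i + 1)) (γ (i + 1))

theorem exists_downward_recursion (s : ℕ → ℕ → ℕ) (N c : ℕ) :
    ∃ K : ℕ → ℕ, (∀ i, N ≤ i → K i = c) ∧ ∀ i, i < N → K i = s i (K (i + 1)) := by
  induction N generalizing c with
  | zero => exact ⟨fun _ => c, fun _ _ => rfl, fun i hi => absurd hi (by omega)⟩
  | succ N ih =>
    obtain ⟨K, hK, hs⟩ := ih (s N c)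
    refine ⟨fun i => if i ≤ N then K i else c, fun i hi => if_neg (by omega), fun i hi => ?_⟩
    rcases Nat.lt_or_ge i N with h | h
    · simp only [if_pos (show i ≤ N by omega), if_pos (show i + 1 ≤ N by omega)]
      exact hs i h
    · obtain rfl : i = N := by omega
      simp [hK]

theorem LocalRule.exists_of_corner {α β γ : ℕ → ℕ} (c : ℕ) (hβ : Interlace α β)
    (hγ : Interlace α γ) (hα : FinitelyManyRows α) : ∃ δ, LocalRule α β γ δ c := by
  obtain ⟨N, hN⟩ := hα
  obtain ⟨K, hK, hs⟩ := exists_downward_recursion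
    (fun i k => k + min (β i) (γ i) + max (β (i + 1)) (γ (i + 1)) -
      (min (max (β (i + 1)) (γ (i + 1)) + k) (α i) + α i)) (N + 1) c
  let δ : ℕ → ℕ := fun i => match i with
    | 0 => max (β 0) (γ 0) + K 0
    | i + 1 => min (max (β (i + 1)) (γ (i + 1)) + K (i + 1)) (α i)
  have hδ : ∀ i, max (β i) (γ i) ≤ δ i ∧ δ (i + 1) ≤ α i := by
    intro i
    refine ⟨?_, min_le_right _ _⟩
    cases i with
    | zero => exact Nat.le_add_right _ _
    | succ i =>
      have h1 := (hβ i).2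
      have h2 := (hγ i).2
      simp only [δ]
      omega
  refine ⟨δ, hβ, hγ, fun i => ?_, fun i => ?_, K, ⟨N + 1, hK⟩, rfl, fun i => ⟨rfl, ?_⟩⟩
  · have h1 := hδ i
    have h2 := (hβ i).1
    omega
  · have h1 := hδ i
    have h2 := (hγ i).1
    omega
  · have h1 := hβ i
    have h2 := hγ i
    simp only [δ]
    rcases Nat.lt_or_ge i (N + 1) with h | h
    · rw [hs i h]
      omega
    · rw [hK i h, hK (i + 1) (by omega)]
      have h3 := hβ (i - 1)
      have h4 := hγ (i - 1)
      rw [show i - 1 + 1 = i by omega, hN (i - 1) (by omega)] at h3 h4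
      omega

theorem LocalRule.corner_unique {α β γ δ δ' : ℕ → ℕ} {c : ℕ} (h : LocalRule α β γ δ c)
    (h' : LocalRule α β γ δ' c) : δ = δ' := by
  obtain ⟨K, ⟨N, hN⟩, h0, hs⟩ := h.carry
  obtain ⟨K', ⟨N', hN'⟩, h0', hs'⟩ := h'.carry
  have key : ∀ k i, i + k = max N N' → K i = K' i := by
    intro k
    induction k with
    | zero => intro i hi; rw [hN i (by omega), hN' i (by omega)]
    | succ k ih =>
      intro i hi
      have h1 := ih (i + 1) (by omega)
      have h2 := hs i
      have h3 := hs' i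
      omega
  have hK : ∀ i, K i = K' i := by
    intro i
    rcases Nat.lt_or_ge i (max N N') with h1 | h1
    · exact key (max N N' - i) i (by omega)
    · rw [hN i (by omega), hN' i (by omega)]
  funext i
  cases i with
  | zero => rw [h0, h0', hK]
  | succ i => rw [(hs i).1, (hs' i).1, hK]

theorem LocalRule.exists_of_opposite_corner {β γ δ : ℕ → ℕ} (hβ : Interlace β δ)
    (hγ : Interlace γ δ) (hδ : FinitelyManyRows δ) : ∃ α c, LocalRule α β γ δ c := by
  obtain ⟨N, hN⟩ := hδ
  -- The overlap `x` of row `i` satisfies `x + y = min (K i + y) s`, where `y` is the part of the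
  -- carry absorbed in row `i + 1` and `s` is the largest possible value of both `x` and `y`.
  let A : ℕ → ℕ → ℕ := fun i k => min (β i) (γ i) -
    (min (k + (δ (i + 1) - max (β (i + 1)) (γ (i + 1))))
      (min (β i) (γ i) - max (β (i + 1)) (γ (i + 1))) -
      (δ (i + 1) - max (β (i + 1)) (γ (i + 1))))
  let K : ℕ → ℕ := fun i => Nat.rec (δ 0 - max (β 0) (γ 0))
    (fun i k => k + δ (i + 1) + A i k - (min (β i) (γ i) + max (β (i + 1)) (γ (i + 1)))) i
  have hK : ∀ i, K (i + 1) =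
      K i + δ (i + 1) + A i (K i) - (min (β i) (γ i) + max (β (i + 1)) (γ (i + 1))) :=
    fun i => rfl
  have hA : ∀ i, A i (K i) = min (β i) (γ i) -
    (min (K i + (δ (i + 1) - max (β (i + 1)) (γ (i + 1))))
      (min (β i) (γ i) - max (β (i + 1)) (γ (i + 1))) -
      (δ (i + 1) - max (β (i + 1)) (γ (i + 1)))) := fun i => rfl
  have hconst : ∀ k, K (N + k) = K N := by
    intro k
    induction k with
    | zero => rfl
    | succ k ih =>
      have h1 := hK (N + k)
      have h2 := hA (N + k)
      have h3 := hβ (N + k)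
      have h4 := hγ (N + k)
      have h5 := hN (N + k) (by omega)
      have h6 := hN (N + k + 1) (by omega)
      have h7 := (hβ (N + k + 1)).1
      have h8 := (hγ (N + k + 1)).1
      rw [show N + (k + 1) = N + k + 1 by omega]
      omega
  refine ⟨fun i => A i (K i), K N, fun i => ?_, fun i => ?_, hβ, hγ, K, ⟨N, fun i hi => ?_⟩,
    ?_, fun i => ?_⟩
  · have h2 := hA i
    have h3 := hβ i
    have h4 := hγ i
    have h7 := (hβ (i + 1)).1
    have h8 := (hγ (i + 1)).1
    omega
  · have h2 := hA i
    have h3 := hβ i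
    have h4 := hγ i
    have h7 := (hβ (i + 1)).1
    have h8 := (hγ (i + 1)).1
    omega
  · obtain ⟨k, rfl⟩ := Nat.exists_eq_add_of_le hi
    exact hconst k
  · have h7 := (hβ 0).1
    have h8 := (hγ 0).1
    change δ 0 = max (β 0) (γ 0) + (δ 0 - max (β 0) (γ 0))
    omega
  · have h1 := hK i
    have h2 := hA i
    have h3 := hβ i
    have h4 := hγ i
    have h7 := (hβ (i + 1)).1
    have h8 := (hγ (i + 1)).1
    constructor <;> omega

theorem LocalRule.opposite_corner_unique {α α' β γ δ : ℕ → ℕ} {c c' : ℕ}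
    (h : LocalRule α β γ δ c) (h' : LocalRule α' β γ δ c') : α = α' ∧ c = c' := by
  obtain ⟨K, ⟨N, hN⟩, h0, hs⟩ := h.carry
  obtain ⟨K', ⟨N', hN'⟩, h0', hs'⟩ := h'.carry
  have step : ∀ i, K i = K' i → α i = α' i ∧ K (i + 1) = K' (i + 1) := by
    intro i hi
    have h1 := hs i
    have h2 := hs' i
    have h3 := h.left i
    have h4 := h.bottom i
    have h5 := h'.left i
    have h6 := h'.bottom i
    omega
  have hK : ∀ i, K i = K' i := by
    intro i
    induction i with
    | zero => omega
    | succ i ih => exact (step i ih).2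
  refine ⟨funext fun i => (step i (hK i)).1, ?_⟩
  rw [← hN (max N N') (le_max_left _ _), ← hN' (max N N') (le_max_right _ _), hK]

/-- Below the rows common to `β` and `γ` the carry is still the entry of the cell. -/
theorem LocalRule.carry_eq {α β γ δ : ℕ → ℕ} {c d : ℕ} (h : LocalRule α β γ δ c)
    {K : ℕ → ℕ} (hc : ∃ N, ∀ i, N ≤ i → K i = c)
    (hs : ∀ i, δ (i + 1) = min (max (β (i + 1)) (γ (i + 1)) + K (i + 1)) (α i) ∧
      K i + δ (i + 1) + α i = K (i + 1) + min (β i) (γ i) + max (β (i + 1)) (γ (i + 1)))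
    (hd : ∀ i, d ≤ i → min (β i) (γ i) = 0) : K d = c := by
  obtain ⟨N, hN⟩ := hc
  have key : ∀ k, K (d + k) = K d := by
    intro k
    induction k with
    | zero => rfl
    | succ k ih =>
      have h1 := hs (d + k)
      have h2 := h.left (d + k)
      have h3 := h.bottom (d + k)
      have h4 := h.top (d + k)
      have h5 := h.right (d + k)
      have h7 := hd (d + k) (by omega)
      rw [show d + (k + 1) = d + k + 1 by omega]
      omega
  rw [← key N, hN _ (by omega)]

/-- The sizes of the partitions satisfy `|δ| + |α| = |β| + |γ| + c`. -/
theorem LocalRule.sum_add_sum {α β γ δ : ℕ → ℕ} {c d : ℕ} (h : LocalRule α β γ δ c)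
    (hd : ∀ i, d ≤ i → δ i = 0) :
    ∑ i ∈ Finset.range d, δ i + ∑ i ∈ Finset.range d, α i =
      ∑ i ∈ Finset.range d, β i + ∑ i ∈ Finset.range d, γ i + c := by
  obtain ⟨K, hN, h0, hs⟩ := h.carry
  have hz : ∀ i, d ≤ i → min (β i) (γ i) = 0 := fun i hi => by
    have h1 := (h.top i).1
    have h2 := hd i hi
    omega
  have hKd := h.carry_eq hN hs hz
  -- The carry equations of the rows below `k` telescope.
  have key : ∀ k, ∑ i ∈ Finset.range k, δ i + ∑ i ∈ Finset.range k, α i +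
      δ k + K 0 + β k + γ k = ∑ i ∈ Finset.range k, β i + ∑ i ∈ Finset.range k, γ i + K k +
        max (β k) (γ k) + K 0 + β k + γ k := by
    intro k
    induction k with
    | zero => simp; omega
    | succ k ih =>
      simp only [Finset.sum_range_succ]
      have h1 := (hs k).2
      omega
  have h1 := key d
  have h2 := hd d le_rfl
  have h3 := (h.top d).1
  have h4 := (h.right d).1
  omega

theorem LocalRule.zero_pos_iff {α β γ δ : ℕ → ℕ} {c : ℕ} (h : LocalRule α β γ δ c) :
    0 < δ 0 ↔ 0 < β 0 ∨ 0 < γ 0 ∨ 0 < c := by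
  obtain ⟨K, hN, h0, hs⟩ := h.carry
  by_cases hm : max (β 0) (γ 0) = 0
  · have h1 : K 0 = c := h.carry_eq hN hs fun i _ => by
      have h2 := h.top.antitone_left (Nat.zero_le i)
      omega
    omega
  · omega

/-- A row of `δ` beyond those of `β` and `γ` is filled precisely when the entry of the cell is
positive and the row before it is a row of `α`. -/
theorem LocalRule.succ_pos_iff {α β γ δ : ℕ → ℕ} {c : ℕ} (h : LocalRule α β γ δ c) (k : ℕ) :
    0 < δ (k + 1) ↔ 0 < β (k + 1) ∨ 0 < γ (k + 1) ∨ (0 < c ∧ 0 < α k) := by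
  obtain ⟨K, hN, h0, hs⟩ := h.carry
  have h3 := (hs k).1
  have h4 := h.left k
  have h5 := h.bottom k
  by_cases hm : max (β (k + 1)) (γ (k + 1)) = 0
  · have h1 : K (k + 1) = c := h.carry_eq hN hs fun i hi => by
      have h2 := h.top.antitone_left hi
      omega
    omega
  · omega

/-! ### Growth diagrams -/

/-- The matrix `m` has positive entries at `k` positions with strictly increasing row indices
below `i` and strictly increasing column indices below `j`. -/
def HasChain (m : ℕ → ℕ → ℕ) : ℕ → ℕ → ℕ → Prop
  | 0, _, _ => True
  | k + 1, i, j => ∃ i' < i, ∃ j' < j, 0 < m i' j' ∧ HasChain m k i' j'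

theorem HasChain.mono {m : ℕ → ℕ → ℕ} {k i j i₁ j₁ : ℕ} (h : HasChain m k i j) (hi : i ≤ i₁)
    (hj : j ≤ j₁) : HasChain m k i₁ j₁ := by
  cases k with
  | zero => trivial
  | succ k =>
    obtain ⟨i', hi', j', hj', hm, hc⟩ := h
    exact ⟨i', by omega, j', by omega, hm, hc⟩

theorem hasChain_succ_iff {m : ℕ → ℕ → ℕ} {k i j : ℕ} :
    HasChain m (k + 1) (i + 1) (j + 1) ↔
      HasChain m (k + 1) i (j + 1) ∨ HasChain m (k + 1) (i + 1) j ∨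
        (0 < m i j ∧ HasChain m k i j) := by
  constructor
  · rintro ⟨i', hi', j', hj', hm, hc⟩
    rcases Nat.lt_or_ge i' i with h | h
    · exact Or.inl ⟨i', h, j', hj', hm, hc⟩
    · rcases Nat.lt_or_ge j' j with h' | h'
      · exact Or.inr (Or.inl ⟨i', hi', j', h', hm, hc⟩)
      · obtain rfl : i' = i := by omega
        obtain rfl : j' = j := by omega
        exact Or.inr (Or.inr ⟨hm, hc⟩)
  · rintro (h | h | ⟨hm, hc⟩)
    · exact h.mono (Nat.le_succ i) le_rfl
    · exact h.mono le_rfl (Nat.le_succ j)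
    · exact ⟨i, Nat.lt_succ_self i, j, Nat.lt_succ_self j, hm, hc⟩

/-- The partitions `Γ i j`, for `i, j ≤ n`, form the growth diagram of the `n × n` matrix `m`. -/
structure IsGrowth (n : ℕ) (m : ℕ → ℕ → ℕ) (Γ : ℕ → ℕ → ℕ → ℕ) : Prop where
  zero_left : ∀ j, j ≤ n → Γ 0 j = 0
  zero_right : ∀ i, i ≤ n → Γ i 0 = 0
  rule : ∀ i j, i < n → j < n →
    LocalRule (Γ i j) (Γ i (j + 1)) (Γ (i + 1) j) (Γ (i + 1) (j + 1)) (m i j)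

theorem interlace_zero : Interlace 0 0 := fun _ => ⟨le_rfl, le_rfl⟩

theorem Interlace.refl_of_eq_zero {α β : ℕ → ℕ} (hα : α = 0) (hβ : β = 0) : Interlace α β := by
  subst hα hβ; exact interlace_zero

theorem finitelyManyRows_zero : FinitelyManyRows 0 := ⟨0, fun _ _ => rfl⟩

namespace IsGrowth

variable {n : ℕ} {m : ℕ → ℕ → ℕ} {Γ : ℕ → ℕ → ℕ → ℕ}

theorem interlace_succ_right (h : IsGrowth n m Γ) {i j : ℕ} (hi : i ≤ n) (hj : j < n) :
    Interlace (Γ i j) (Γ i (j + 1)) := by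
  cases i with
  | zero => exact .refl_of_eq_zero (h.zero_left j hj.le) (h.zero_left (j + 1) hj)
  | succ i => exact (h.rule i j hi hj).right

theorem interlace_succ_left (h : IsGrowth n m Γ) {i j : ℕ} (hi : i < n) (hj : j ≤ n) :
    Interlace (Γ i j) (Γ (i + 1) j) := by
  cases j with
  | zero => exact .refl_of_eq_zero (h.zero_right i hi.le) (h.zero_right (i + 1) hi)
  | succ j => exact (h.rule i j hi hj).top

theorem apply_le_last (h : IsGrowth n m Γ) {i j : ℕ} (hi : i ≤ n) (hj : j ≤ n) (k : ℕ) :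
    Γ i j k ≤ Γ n n k := by
  have h1 : Γ i j k ≤ Γ i n k :=
    Nat.decreasingInduction' (P := fun j => Γ i j k ≤ Γ i n k)
      (fun j hj _ ih => ((h.interlace_succ_right hi hj) k).1.trans ih) hj le_rfl
  have h2 : Γ i n k ≤ Γ n n k :=
    Nat.decreasingInduction' (P := fun i => Γ i n k ≤ Γ n n k)
      (fun i hi _ ih => ((h.interlace_succ_left hi le_rfl) k).1.trans ih) hi le_rfl
  exact h1.trans h2

/-- The number of rows of `Γ i j` is the length of a longest chain in the corresponding
submatrix. -/
theorem pos_iff_hasChain (h : IsGrowth n m Γ) (k : ℕ) {i j : ℕ} (hi : i ≤ n) (hj : j ≤ n) :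
    0 < Γ i j k ↔ HasChain m (k + 1) i j := by
  induction i generalizing j k with
  | zero => simp [h.zero_left j hj, HasChain]
  | succ i ihi =>
    induction j generalizing k with
    | zero => simp [h.zero_right _ hi, HasChain]
    | succ j ihj =>
      have hr := h.rule i j hi hj
      rw [hasChain_succ_iff, ← ihi k (by omega) hj, ← ihj k (by omega)]
      cases k with
      | zero => rw [hr.zero_pos_iff]; simp [HasChain]
      | succ k => rw [hr.succ_pos_iff, ihi k (by omega) (by omega)]

theorem sum_eq (h : IsGrowth n m Γ) {d : ℕ} (hd : ∀ k, d ≤ k → Γ n n k = 0) {i j : ℕ}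
    (hi : i ≤ n) (hj : j ≤ n) :
    ∑ k ∈ Finset.range d, Γ i j k =
      ∑ i' ∈ Finset.range i, ∑ j' ∈ Finset.range j, m i' j' := by
  induction i generalizing j with
  | zero => simp [h.zero_left j hj]
  | succ i ihi =>
    induction j with
    | zero => simp [h.zero_right _ hi]
    | succ j ihj =>
      have hr := (h.rule i j hi hj).sum_add_sum (d := d) fun k hk => by
        have h1 := h.apply_le_last hi hj k
        have h2 := hd k hk
        omega
      have h1 := ihi (j := j) (by omega) (by omega)
      have h2 := ihi (j := j + 1) (by omega) hj
      have h3 := ihj (by omega)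
      rw [Finset.sum_range_succ] at h3 ⊢
      rw [Finset.sum_range_succ (fun j' => m i j')]
      omega

theorem unique {Γ' : ℕ → ℕ → ℕ → ℕ} (h : IsGrowth n m Γ) (h' : IsGrowth n m Γ') {i j : ℕ}
    (hi : i ≤ n) (hj : j ≤ n) : Γ i j = Γ' i j := by
  induction i generalizing j with
  | zero => rw [h.zero_left j hj, h'.zero_left j hj]
  | succ i ihi =>
    induction j with
    | zero => rw [h.zero_right _ hi, h'.zero_right _ hi]
    | succ j ihj =>
      have h1 := h.rule i j hi hj
      have h2 := h'.rule i j hi hj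
      rw [ihi (by omega) (by omega), ihi (by omega) hj, ihj (by omega)] at h1
      exact h1.corner_unique h2

theorem unique_of_boundary {m' : ℕ → ℕ → ℕ} {Γ' : ℕ → ℕ → ℕ → ℕ} (h : IsGrowth n m Γ)
    (h' : IsGrowth n m' Γ') (hb : ∀ k, k ≤ n → Γ n k = Γ' n k ∧ Γ k n = Γ' k n) {i j : ℕ}
    (hi : i < n) (hj : j < n) : m i j = m' i j := by
  have key : ∀ s i, i + s = n → ∀ t j, j + t = n → Γ i j = Γ' i j := by
    intro s
    induction s with
    | zero => rintro i rfl t j hj; exact (hb j (by omega)).1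
    | succ s ihs =>
      intro i hi t
      induction t with
      | zero => rintro j rfl; exact (hb i (by omega)).2
      | succ t iht =>
        intro j hj
        have h1 := h.rule i j (by omega) (by omega)
        have h2 := h'.rule i j (by omega) (by omega)
        rw [ihs (i + 1) (by omega) t (j + 1) (by omega),
          ihs (i + 1) (by omega) (t + 1) j (by omega), iht (j + 1) (by omega)] at h1
        exact (h1.opposite_corner_unique h2).1
  have h1 := h.rule i j hi hj
  have h2 := h'.rule i j hi hj
  rw [key (n - (i + 1)) (i + 1) (by omega) (n - (j + 1)) (j + 1) (by omega),
    key (n - (i + 1)) (i + 1) (by omega) (n - j) j (by omega),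
    key (n - i) i (by omega) (n - (j + 1)) (j + 1) (by omega)] at h1
  exact (h1.opposite_corner_unique h2).2

end IsGrowth

/-- A grid can be filled from two adjacent sides when each cell can be completed from three of
its corners, `H` and `V` being conditions on horizontally and vertically adjacent vertices. -/
theorem exists_grid {X : Type*} (R : ℕ → ℕ → X → X → X → X → Prop) (H V : X → X → Prop)
    (f g : ℕ → X) (h0 : f 0 = g 0) (hf : ∀ j, H (f j) (f (j + 1)))
    (hg : ∀ i, V (g i) (g (i + 1)))
    (hR : ∀ i j a b c, H a b → V a c → ∃ d, R i j a b c d ∧ V b d ∧ H c d) :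
    ∃ Γ : ℕ → ℕ → X, (∀ j, Γ 0 j = f j) ∧ (∀ i, Γ i 0 = g i) ∧
      ∀ i j, R i j (Γ i j) (Γ i (j + 1)) (Γ (i + 1) j) (Γ (i + 1) (j + 1)) := by
  have hne : Nonempty X := ⟨f 0⟩
  choose! F hF using hR
  let row : ℕ → (ℕ → X) → ℕ → X := fun i ρ j =>
    Nat.rec (g (i + 1)) (fun j x => F i j (ρ j) (ρ (j + 1)) x) j
  let Γ : ℕ → ℕ → X := fun i => Nat.rec f (fun i ρ => row i ρ) i
  have hs : ∀ i j, Γ (i + 1) (j + 1) = F i j (Γ i j) (Γ i (j + 1)) (Γ (i + 1) j) :=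
    fun _ _ => rfl
  have hl : ∀ i, Γ i 0 = g i := fun i => by
    cases i with
    | zero => exact h0
    | succ i => rfl
  have hH : ∀ i, (∀ j, H (Γ i j) (Γ i (j + 1))) ∧ ∀ j, V (Γ i j) (Γ (i + 1) j) := by
    intro i
    induction i with
    | zero =>
      refine ⟨hf, fun j => ?_⟩
      induction j with
      | zero => exact (hl 0).symm ▸ hg 0
      | succ j ih => rw [hs]; exact (hF 0 j _ _ _ (hf j) ih).2.1
    | succ i ih =>
      have hH' : ∀ j, H (Γ (i + 1) j) (Γ (i + 1) (j + 1)) := fun j => by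
        rw [hs]; exact (hF i j _ _ _ (ih.1 j) (ih.2 j)).2.2
      refine ⟨hH', fun j => ?_⟩
      induction j with
      | zero => exact hg (i + 1)
      | succ j ih' => rw [hs (i + 1)]; exact (hF (i + 1) j _ _ _ (hH' j) ih').2.1
  refine ⟨Γ, fun _ => rfl, hl, fun i j => ?_⟩
  rw [hs]
  exact (hF i j _ _ _ ((hH i).1 j) ((hH i).2 j)).1

theorem IsGrowth.exists (n : ℕ) (m : ℕ → ℕ → ℕ) : ∃ Γ, IsGrowth n m Γ := by
  obtain ⟨Γ, h1, h2, h3⟩ := exists_grid (X := ℕ → ℕ)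
    (fun i j α β γ δ => LocalRule α β γ δ (m i j))
    (fun α β => Interlace α β ∧ FinitelyManyRows α)
    (fun α β => Interlace α β ∧ FinitelyManyRows α) 0 0 rfl
    (fun _ => ⟨interlace_zero, finitelyManyRows_zero⟩)
    (fun _ => ⟨interlace_zero, finitelyManyRows_zero⟩)
    (fun i j α β γ hβ hγ => by
      obtain ⟨δ, hδ⟩ := LocalRule.exists_of_corner (m i j) hβ.1 hγ.1 hβ.2
      exact ⟨δ, hδ, ⟨hδ.top, hβ.1.finitelyManyRows hβ.2⟩,
        ⟨hδ.right, hγ.1.finitelyManyRows hβ.2⟩⟩)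
  exact ⟨Γ, fun j _ => h1 j, fun i _ => h2 i, fun i j _ _ => h3 i j⟩

/-! ### Semistandard tableaux as chains of partitions -/

/-- A semistandard tableau with at most `d` rows and with `r` entries equal to each of
`0, …, n - 1`: the partition `p k` is the shape formed by the entries less than `k`. For `k > n`
the value `p k` carries no information and is fixed to be `p n`. -/
structure IsTableau (n r d : ℕ) (p : ℕ → ℕ → ℕ) : Prop where
  zero : p 0 = 0
  interlace : ∀ k, k < n → Interlace (p k) (p (k + 1))
  eq_last : ∀ k, n ≤ k → p k = p n
  rows : ∀ k i, d ≤ i → p k i = 0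
  sum_eq : ∀ k, k ≤ n → ∑ i ∈ Finset.range d, p k i = k * r

/-- The `n × n` matrices with all row and column sums `r` and without chains of more than `d`
positive entries; as functions on `ℕ × ℕ` they vanish outside of the square. -/
structure IsBoundedMatrix (n r d : ℕ) (m : ℕ → ℕ → ℕ) : Prop where
  outside : ∀ i j, n ≤ i ∨ n ≤ j → m i j = 0
  sum_row : ∀ i, i < n → ∑ j ∈ Finset.range n, m i j = r
  sum_col : ∀ j, j < n → ∑ i ∈ Finset.range n, m i j = r
  not_hasChain : ¬ HasChain m (d + 1) n n

theorem IsTableau.interlace' {n r d : ℕ} {p : ℕ → ℕ → ℕ} (h : IsTableau n r d p) (k : ℕ) :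
    Interlace (p (n - (k + 1))) (p (n - k)) := by
  rcases Nat.lt_or_ge k n with hk | hk
  · have h1 := h.interlace (n - (k + 1)) (by omega)
    rwa [show n - (k + 1) + 1 = n - k by omega] at h1
  · exact .refl_of_eq_zero (by rw [show n - (k + 1) = 0 by omega, h.zero])
      (by rw [show n - k = 0 by omega, h.zero])

/-- The inverse of the correspondence: two tableaux of the same shape are the two far sides of a
growth diagram. -/
theorem IsGrowth.exists_of_boundary {n r d : ℕ} {p q : ℕ → ℕ → ℕ} (hp : IsTableau n r d p)
    (hq : IsTableau n r d q) (hpq : p n = q n) :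
    ∃ m Γ, (∀ i j, n ≤ i ∨ n ≤ j → m i j = 0) ∧ IsGrowth n m Γ ∧
      ∀ k, k ≤ n → Γ n k = p k ∧ Γ k n = q k := by
  -- The grid is filled from the corner `(n, n)`, so both coordinates run backwards.
  obtain ⟨Δ, h1, h2, h3⟩ := exists_grid (X := ℕ → ℕ)
    (fun _ _ δ γ β α => ∃ c, LocalRule α β γ δ c)
    (fun β α => Interlace α β ∧ FinitelyManyRows β)
    (fun β α => Interlace α β ∧ FinitelyManyRows β)
    (fun j => p (n - j)) (fun i => q (n - i)) hpq
    (fun j => ⟨hp.interlace' j, d, fun i hi => hp.rows _ i hi⟩)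
    (fun j => ⟨hq.interlace' j, d, fun i hi => hq.rows _ i hi⟩)
    (fun i j δ γ β hγ hβ => by
      obtain ⟨α, c, hα⟩ := LocalRule.exists_of_opposite_corner hβ.1 hγ.1 hβ.2
      exact ⟨α, ⟨c, hα⟩, ⟨hα.bottom, hγ.1.finitelyManyRows' hβ.2⟩,
        ⟨hα.left, hβ.1.finitelyManyRows' hβ.2⟩⟩)
  choose c hc using h3
  have hz1 : ∀ t, Δ n t = 0 := by
    intro t
    induction t with
    | zero => rw [h2, Nat.sub_self, hq.zero]
    | succ t ih =>
      funext k
      have hle : Δ n (t + 1) k ≤ Δ n t k := by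
        cases n with
        | zero => rw [h1, h1]; simp
        | succ n => exact ((hc n t).left k).1
      rw [ih] at hle
      exact Nat.le_zero.mp hle
  have hz2 : ∀ s, Δ s n = 0 := by
    intro s
    induction s with
    | zero => rw [h1, Nat.sub_self, hp.zero]
    | succ s ih =>
      funext k
      have hle : Δ (s + 1) n k ≤ Δ s n k := by
        cases n with
        | zero => rw [h2, h2]; simp
        | succ n => exact ((hc s n).bottom k).1
      rw [ih] at hle
      exact Nat.le_zero.mp hle
  refine ⟨fun i j => if i < n ∧ j < n then c (n - (i + 1)) (n - (j + 1)) else 0,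
    fun i j => Δ (n - i) (n - j), fun i j hij => if_neg (by omega),
    ⟨fun j _ => hz1 _, fun i _ => hz2 _, fun i j hi hj => ?_⟩, fun k hk => ⟨?_, ?_⟩⟩
  · have h := hc (n - (i + 1)) (n - (j + 1))
    rw [show n - (i + 1) + 1 = n - i by omega, show n - (j + 1) + 1 = n - j by omega] at h
    rw [if_pos ⟨hi, hj⟩]
    exact h
  · simp only [Nat.sub_self, h1, Nat.sub_sub_self hk]
  · simp only [Nat.sub_self, h2, Nat.sub_sub_self hk]

theorem isTableau_of_boundary {n r d : ℕ} {p : ℕ → ℕ → ℕ} (h0 : p 0 = 0)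
    (h1 : ∀ k, k < n → Interlace (p k) (p (k + 1))) (h2 : ∀ k, k ≤ n → ∀ i, p k i ≤ p n i)
    (h3 : ∀ i, d ≤ i → p n i = 0)
    (h4 : ∀ k, k ≤ n → ∑ i ∈ Finset.range d, p k i = k * r) :
    IsTableau n r d fun k => p (min k n) where
  zero := by simpa using h0
  interlace k hk := by
    have h := h1 k hk
    rwa [min_eq_left hk.le, min_eq_left (show k + 1 ≤ n from hk)]
  eq_last k hk := by rw [min_eq_right hk, min_self]
  rows k i hi := by
    have h := h2 (min k n) (min_le_right _ _) i
    rw [h3 i hi] at h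
    exact Nat.le_zero.mp h
  sum_eq k hk := by rw [min_eq_left hk]; exact h4 k hk

/-- Burge's variant of the Robinson–Schensted–Knuth correspondence. -/
theorem exists_bijective_boundedMatrix_tableau (n r d : ℕ) :
    ∃ f : {m | IsBoundedMatrix n r d m} →
        {pq : (ℕ → ℕ → ℕ) × (ℕ → ℕ → ℕ) |
          IsTableau n r d pq.1 ∧ IsTableau n r d pq.2 ∧ pq.1 n = pq.2 n},
      Function.Bijective f := by
  refine exists_bijective_of_rel _ _
    (fun m pq => ∃ Γ, IsGrowth n m Γ ∧ ∀ k, k ≤ n → Γ n k = pq.1 k ∧ Γ k n = pq.2 k) ?_ ?_ ?_ ?_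
  · intro m hm
    obtain ⟨Γ, hΓ⟩ := IsGrowth.exists n m
    have hd : Γ n n d = 0 := by
      have h := mt (hΓ.pos_iff_hasChain d le_rfl le_rfl).1 hm.not_hasChain
      omega
    have hanti : Antitone (Γ n n) := by
      cases n with
      | zero => rw [hΓ.zero_left 0 le_rfl]; exact antitone_const
      | succ n => exact (hΓ.rule n n (by omega) (by omega)).top.antitone_right
    have hrows : ∀ k, d ≤ k → Γ n n k = 0 := fun k hk => Nat.le_zero.mp (hd ▸ hanti hk)
    refine ⟨(fun k => Γ n (min k n), fun k => Γ (min k n) n),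
      ⟨isTableau_of_boundary (hΓ.zero_right n le_rfl)
        (fun k hk => hΓ.interlace_succ_right le_rfl hk)
        (fun k hk => hΓ.apply_le_last le_rfl hk) hrows fun k hk => ?_,
      isTableau_of_boundary (p := fun k => Γ k n) (hΓ.zero_left n le_rfl)
        (fun k hk => hΓ.interlace_succ_left hk le_rfl)
        (fun k hk => hΓ.apply_le_last hk le_rfl) hrows fun k hk => ?_, by simp⟩,
      Γ, hΓ, fun k hk => by simp [hk]⟩
    · rw [hΓ.sum_eq hrows le_rfl hk, Finset.sum_comm, Finset.sum_congr rfl fun j hj =>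
        hm.sum_col j (by have := Finset.mem_range.1 hj; omega)]
      simp
    · rw [hΓ.sum_eq hrows hk le_rfl, Finset.sum_congr rfl fun j hj =>
        hm.sum_row j (by have := Finset.mem_range.1 hj; omega)]
      simp
  · rintro ⟨p, q⟩ ⟨hp, hq, hpq⟩
    obtain ⟨m, Γ, hm, hΓ, hb⟩ := IsGrowth.exists_of_boundary hp hq hpq
    have hrows : ∀ k, d ≤ k → Γ n n k = 0 := fun k hk => by
      rw [(hb n le_rfl).1, hp.rows _ _ hk]
    refine ⟨m, ⟨hm, fun i hi => ?_, fun j hj => ?_, fun hc => ?_⟩, Γ, hΓ, hb⟩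
    · have h1 := hΓ.sum_eq hrows (show i + 1 ≤ n from hi) le_rfl
      have h2 := hΓ.sum_eq hrows hi.le le_rfl
      rw [(hb _ hi).2, hq.sum_eq _ hi, Finset.sum_range_succ, ← h2, (hb _ hi.le).2,
        hq.sum_eq _ hi.le, Nat.succ_mul] at h1
      exact (Nat.add_left_cancel h1).symm
    · have h1 := hΓ.sum_eq hrows le_rfl (show j + 1 ≤ n from hj)
      have h2 := hΓ.sum_eq hrows le_rfl hj.le
      rw [Finset.sum_comm] at h1 h2
      rw [(hb _ hj).1, hp.sum_eq _ hj, Finset.sum_range_succ, ← h2, (hb _ hj.le).1,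
        hp.sum_eq _ hj.le, Nat.succ_mul] at h1
      exact (Nat.add_left_cancel h1).symm
    · have h := (hΓ.pos_iff_hasChain d le_rfl le_rfl).2 hc
      rw [hrows d le_rfl] at h
      exact lt_irrefl _ h
  · rintro m - ⟨p, q⟩ ⟨hp, hq, -⟩ ⟨p', q'⟩ ⟨hp', hq', -⟩ ⟨Γ, hΓ, hb⟩ ⟨Γ', hΓ', hb'⟩
    have key : ∀ k, p (min k n) = p' (min k n) ∧ q (min k n) = q' (min k n) := fun k => by
      have hk : min k n ≤ n := min_le_right _ _
      exact ⟨(hb _ hk).1.symm.trans ((hΓ.unique hΓ' le_rfl hk).trans (hb' _ hk).1),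
        (hb _ hk).2.symm.trans ((hΓ.unique hΓ' hk le_rfl).trans (hb' _ hk).2)⟩
    have hmin : ∀ {s}, IsTableau n r d s → ∀ k, s k = s (min k n) := fun hs k => by
      rcases le_total k n with hk | hk
      · rw [min_eq_left hk]
      · rw [min_eq_right hk, hs.eq_last k hk]
    refine Prod.ext (funext fun k => ?_) (funext fun k => ?_)
    · exact (hmin hp k).trans ((key k).1.trans (hmin hp' k).symm)
    · exact (hmin hq k).trans ((key k).2.trans (hmin hq' k).symm)
  · rintro ⟨p, q⟩ - m hm m' hm' ⟨Γ, hΓ, hb⟩ ⟨Γ', hΓ', hb'⟩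
    funext i j
    by_cases hij : i < n ∧ j < n
    · exact hΓ.unique_of_boundary hΓ' (fun k hk => by
        rw [(hb k hk).1, (hb k hk).2, (hb' k hk).1, (hb' k hk).2]; exact ⟨rfl, rfl⟩) hij.1 hij.2
    · rw [hm.outside i j (by omega), hm'.outside i j (by omega)]

/-! ### Intervals attached to a composition of `r` -/

section Above

variable {ι : Type*} [LinearOrder ι] [Fintype ι]

/-- The sum of the values of `c` at the elements greater than `v`. When `c` has sum `r`, the
intervals `[above c v, above c v + c v)` partition `[0, r)`, in decreasing order of `v`. -/
def above (c : ι → ℕ) (v : ι) : ℕ :=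
  ∑ w ∈ Finset.univ.filter (fun w => v < w), c w

theorem above_add_self (c : ι → ℕ) (v : ι) :
    above c v + c v = ∑ w ∈ Finset.univ.filter (fun w => v ≤ w), c w := by
  have h : Finset.univ.filter (fun w => v ≤ w) =
      insert v (Finset.univ.filter fun w => v < w) := by
    ext w
    simp [le_iff_eq_or_lt, eq_comm]
  rw [h, Finset.sum_insert (by simp), add_comm, above]

theorem above_add_self_le_sum (c : ι → ℕ) (v : ι) : above c v + c v ≤ ∑ w, c w := by
  rw [above_add_self]
  exact Finset.sum_le_sum_of_subset (Finset.filter_subset _ _)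

theorem above_add_self_le_above (c : ι → ℕ) {v w : ι} (h : v < w) :
    above c w + c w ≤ above c v := by
  rw [above_add_self]
  refine Finset.sum_le_sum_of_subset fun x hx => ?_
  simp only [Finset.mem_filter, Finset.mem_univ, true_and] at hx ⊢
  exact h.trans_le hx

theorem eq_of_mem_interval {c : ι → ℕ} {k : ℕ} {v w : ι}
    (hv : above c v ≤ k ∧ k < above c v + c v) (hw : above c w ≤ k ∧ k < above c w + c w) :
    v = w := by
  rcases lt_trichotomy v w with h | h | h
  · have := above_add_self_le_above c h
    omega
  · exact h
  · have := above_add_self_le_above c h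
    omega

theorem exists_mem_interval {c : ι → ℕ} {k : ℕ} (hk : k < ∑ w, c w) :
    ∃ v, above c v ≤ k ∧ k < above c v + c v := by
  have hne : Nonempty ι := by
    by_contra h
    rw [not_nonempty_iff] at h
    simp at hk
  let S : Finset ι := Finset.univ.filter fun v => k < above c v + c v
  have hS : S.Nonempty := by
    obtain ⟨v, hv⟩ : ∃ v : ι, ∀ w, v ≤ w := Finite.exists_min id
    refine ⟨v, ?_⟩
    simp only [S, Finset.mem_filter, Finset.mem_univ, true_and, above_add_self]
    rwa [Finset.filter_true_of_mem fun w _ => hv w]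
  obtain ⟨v, hv, hmax⟩ := S.exists_max_image id hS
  refine ⟨v, ?_, (Finset.mem_filter.1 hv).2⟩
  by_contra! hlt
  have hT : (Finset.univ.filter fun w => v < w).Nonempty := by
    rw [Finset.nonempty_iff_ne_empty]
    intro h
    rw [above, h] at hlt
    simp at hlt
  obtain ⟨w, hw, hmin⟩ := (Finset.univ.filter fun w => v < w).exists_min_image id hT
  simp only [Finset.mem_filter, Finset.mem_univ, true_and, id] at hw hmin
  have hwS : w ∈ S := by
    simp only [S, Finset.mem_filter, Finset.mem_univ, true_and, above_add_self]
    refine hlt.trans_le (Finset.sum_le_sum_of_subset fun x hx => ?_)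
    simp only [Finset.mem_filter, Finset.mem_univ, true_and] at hx ⊢
    exact hmin x hx
  exact absurd (hmax w hwS) (not_le.2 hw)

theorem card_interval {r : ℕ} {c : ι → ℕ} (hc : ∑ w, c w = r) (v : ι) :
    (Finset.univ.filter fun k : Fin r => above c v ≤ k ∧ (k : ℕ) < above c v + c v).card =
      c v := by
  have h := above_add_self_le_sum c v
  have h1 : (Finset.univ.filter fun k : Fin r =>
      above c v ≤ k ∧ (k : ℕ) < above c v + c v).map Fin.valEmbedding =
        Finset.Ico (above c v) (above c v + c v) := by
    ext k
    simp only [Finset.mem_map, Finset.mem_filter, Finset.mem_univ, true_and, Finset.mem_Ico,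
      Fin.valEmbedding_apply]
    exact ⟨fun ⟨a, ha, hk⟩ => hk ▸ ha, fun hk => ⟨⟨k, by omega⟩, hk, rfl⟩⟩
  rw [← Finset.card_map, h1, Nat.card_Ico, Nat.add_sub_cancel_left]

end Above

/-! ### Configurations and regular multigraphs -/

section Configurations

variable {U V : Type*} [LinearOrder U] [LinearOrder V] [Fintype U] [Fintype V]

/-- A form of the definition of `BarEdge` that is symmetric in the two colour classes. -/
theorem barEdge_iff {r : ℕ} (G : BipMultigraph U V) (x : U × Fin r) (y : V × Fin r) :
    BarEdge G x y ↔ above (G.mult x.1) y.1 ≤ x.2 ∧ above (fun u => G.mult u y.1) x.1 ≤ y.2 ∧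
      (x.2 : ℕ) + y.2 + 1 =
        above (G.mult x.1) y.1 + above (fun u => G.mult u y.1) x.1 + G.mult x.1 y.1 := by
  change (∃ s : ℕ, 1 ≤ s ∧ s ≤ G.mult x.1 y.1 ∧
    (x.2 : ℕ) + 1 = above (G.mult x.1) y.1 + s ∧
    (y.2 : ℕ) + 1 = above (fun u => G.mult u y.1) x.1 + (G.mult x.1 y.1 - s) + 1) ↔ _
  constructor
  · rintro ⟨s, h1, h2, h3, h4⟩
    omega
  · rintro ⟨h1, h2, h3⟩
    exact ⟨x.2 + 1 - above (G.mult x.1) y.1, by omega, by omega, by omega, by omega⟩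

theorem BarEdge.mem_interval {r : ℕ} {G : BipMultigraph U V} {x : U × Fin r} {y : V × Fin r}
    (h : BarEdge G x y) : above (G.mult x.1) y.1 ≤ x.2 ∧
      (x.2 : ℕ) < above (G.mult x.1) y.1 + G.mult x.1 y.1 := by
  rw [barEdge_iff] at h
  omega

theorem barEdge_transpose {r : ℕ} (G : BipMultigraph U V) (x : U × Fin r) (y : V × Fin r) :
    BarEdge ⟨fun v u => G.mult u v⟩ y x ↔ BarEdge G x y := by
  have h : above (fun v => G.mult x.1 v) y.1 = above (G.mult x.1) y.1 := rfl
  simp only [barEdge_iff]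
  omega

theorem existsUnique_barEdge {r : ℕ} {G : BipMultigraph U V} (hG : G.IsRegular r)
    (x : U × Fin r) : ∃! y, BarEdge G x y := by
  obtain ⟨u, k⟩ := x
  obtain ⟨v, hv⟩ := exists_mem_interval (c := G.mult u) (k := k) (by rw [hG.1 u]; exact k.2)
  have h1 := above_add_self_le_sum (fun u => G.mult u v) u
  rw [hG.2 v] at h1
  refine ⟨(v, ⟨above (G.mult u) v + above (fun u => G.mult u v) u + G.mult u v - k - 1,
    by omega⟩), ?_, ?_⟩
  · refine (barEdge_iff G _ _).2 ?_
    dsimp only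
    omega
  · rintro ⟨w, l⟩ hw
    obtain rfl : w = v := eq_of_mem_interval hw.mem_interval hv
    rw [barEdge_iff] at hw
    refine Prod.ext rfl (Fin.ext ?_)
    dsimp only at hw ⊢
    omega

theorem existsUnique_barEdge' {r : ℕ} {G : BipMultigraph U V} (hG : G.IsRegular r)
    (y : V × Fin r) : ∃! x, BarEdge G x y := by
  have h := existsUnique_barEdge (G := ⟨fun v u => G.mult u v⟩) ⟨hG.2, hG.1⟩ y
  simpa only [barEdge_transpose] using h

theorem exists_isAssociated {r : ℕ} {G : BipMultigraph U V} (hG : G.IsRegular r) :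
    ∃ F : Configuration U V r, IsAssociated G F := by
  choose f hf huniq using existsUnique_barEdge hG
  have hbij : Function.Bijective f := by
    refine ⟨fun x x' h => ?_, fun y => ?_⟩
    · exact (existsUnique_barEdge' hG (f x)).unique (hf x) (h ▸ hf x')
    · obtain ⟨x, hx, -⟩ := existsUnique_barEdge' hG y
      exact ⟨x, (huniq x y hx).symm⟩
  refine ⟨Equiv.ofBijective f hbij, fun x y => ⟨?_, fun h => (huniq x y h).symm⟩⟩
  rintro rfl
  exact hf x

theorem IsAssociated.mult_eq {r : ℕ} {G : BipMultigraph U V} {F : Configuration U V r}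
    (h : IsAssociated G F) (hG : G.IsRegular r) (u : U) (v : V) :
    G.mult u v = (Finset.univ.filter fun k : Fin r => (F (u, k)).1 = v).card := by
  rw [← card_interval (hG.1 u) v]
  congr 1
  ext k
  have h1 := ((h (u, k) (F (u, k))).1 rfl).mem_interval
  simp only [Finset.mem_filter, Finset.mem_univ, true_and]
  constructor
  · exact fun hk => eq_of_mem_interval h1 hk
  · rintro rfl
    exact h1

theorem exists_bijective_configuration_graph (U V : Type*) [LinearOrder U] [LinearOrder V]
    [Fintype U] [Fintype V] (r d : ℕ) :
    ∃ f : regularConfigurations U V r d → regularGraphs U V r d, Function.Bijective f := by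
  refine exists_bijective_of_rel _ _ (fun F G => IsAssociated G F) ?_ ?_ ?_ ?_
  · rintro F ⟨G, hG, h⟩
    exact ⟨G, hG, h⟩
  · intro G hG
    obtain ⟨F, hF⟩ := exists_isAssociated hG.1
    exact ⟨F, ⟨G, hG, hF⟩, hF⟩
  · intro F _ G hG G' hG' h h'
    ext u v
    rw [h.mult_eq hG.1, h'.mult_eq hG'.1]
  · intro G _ F _ F' _ h h'
    exact Equiv.ext fun x => ((h' x (F x)).2 ((h x (F x)).1 rfl)).symm

end Configurations

/-! ### Planar matchings and chains in matrices -/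

section Matchings

variable {U V : Type*} [LinearOrder U] [LinearOrder V] {n : ℕ} (eU : U ≃o Fin n)
  (eV : V ≃o Fin n) {G : BipMultigraph U V} {m : ℕ → ℕ → ℕ}

theorem exists_planarMatching_of_hasChain (hm : ∀ u v, m (eU u) (eV v) = G.mult u v)
    {k i j : ℕ} (hi : i ≤ n) (hj : j ≤ n) (h : HasChain m k i j) :
    ∃ M : Finset (U × V), IsPlanarMatching G M ∧ M.card = k ∧
      ∀ e ∈ M, (eU e.1 : ℕ) < i ∧ (eV e.2 : ℕ) < j := by
  induction k generalizing i j with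
  | zero => exact ⟨∅, ⟨by simp, by simp, by simp⟩, rfl, by simp⟩
  | succ k ih =>
    obtain ⟨i', hi', j', hj', hpos, hc⟩ := h
    obtain ⟨M, hM, hcard, hlt⟩ := ih (by omega) (by omega) hc
    obtain ⟨u, hu⟩ := eU.surjective ⟨i', by omega⟩
    obtain ⟨v, hv⟩ := eV.surjective ⟨j', by omega⟩
    have hlt' : ∀ e ∈ M, e.1 < u ∧ e.2 < v := by
      intro e he
      rw [← eU.lt_iff_lt, ← eV.lt_iff_lt, hu, hv]
      exact hlt e he
    refine ⟨insert (u, v) M, ⟨?_, ?_, ?_⟩, ?_, ?_⟩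
    · intro e he
      rcases Finset.mem_insert.1 he with rfl | he
      · rw [← hm, hu, hv]
        exact hpos
      · exact hM.isEdge e he
    · intro e he f hf hne
      rcases Finset.mem_insert.1 he with rfl | he <;> rcases Finset.mem_insert.1 hf with rfl | hf
      · exact absurd rfl hne
      · exact ⟨(hlt' f hf).1.ne', (hlt' f hf).2.ne'⟩
      · exact ⟨(hlt' e he).1.ne, (hlt' e he).2.ne⟩
      · exact hM.disjoint e he f hf hne
    · intro e he f hf hne
      rcases Finset.mem_insert.1 he with rfl | he <;> rcases Finset.mem_insert.1 hf with rfl | hf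
      · exact absurd rfl hne
      · exact Or.inr (hlt' f hf)
      · exact Or.inl (hlt' e he)
      · exact hM.noncrossing e he f hf hne
    · rw [Finset.card_insert_of_notMem fun h => lt_irrefl _ (hlt' _ h).1, hcard]
    · intro e he
      rcases Finset.mem_insert.1 he with rfl | he
      · rw [hu, hv]
        exact ⟨hi', hj'⟩
      · have := hlt e he
        omega

theorem hasChain_of_planarMatching (hm : ∀ u v, m (eU u) (eV v) = G.mult u v) {k i j : ℕ}
    {M : Finset (U × V)} (hM : IsPlanarMatching G M) (hk : k ≤ M.card)
    (hlt : ∀ e ∈ M, (eU e.1 : ℕ) < i ∧ (eV e.2 : ℕ) < j) : HasChain m k i j := by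
  induction k generalizing i j M with
  | zero => trivial
  | succ k ih =>
    obtain ⟨e, he, hmax⟩ := M.exists_max_image Prod.fst (Finset.card_pos.1 (by omega))
    refine ⟨eU e.1, (hlt e he).1, eV e.2, (hlt e he).2, ?_, ih (M := M.erase e) ⟨?_, ?_, ?_⟩ ?_ ?_⟩
    · rw [hm]
      exact hM.isEdge e he
    · exact fun f hf => hM.isEdge f (Finset.mem_of_mem_erase hf)
    · exact fun f hf g hg =>
        hM.disjoint f (Finset.mem_of_mem_erase hf) g (Finset.mem_of_mem_erase hg)
    · exact fun f hf g hg =>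
        hM.noncrossing f (Finset.mem_of_mem_erase hf) g (Finset.mem_of_mem_erase hg)
    · rw [Finset.card_erase_of_mem he]
      omega
    · intro f hf
      have hfM := Finset.mem_of_mem_erase hf
      have h : f.1 < e.1 ∧ f.2 < e.2 := by
        rcases hM.noncrossing f hfM e he (Finset.ne_of_mem_erase hf) with h | h
        · exact h
        · exact absurd (hmax f hfM) (not_le.2 h.1)
      exact ⟨eU.lt_iff_lt.2 h.1, eV.lt_iff_lt.2 h.2⟩

theorem largestPlanar_le_iff [Fintype U] [Fintype V]
    (hm : ∀ u v, m (eU u) (eV v) = G.mult u v) (d : ℕ) :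
    largestPlanar G ≤ d ↔ ¬ HasChain m (d + 1) n n := by
  classical
  rw [largestPlanar, Finset.sup_le_iff]
  constructor
  · intro h hc
    obtain ⟨M, hM, hcard, -⟩ := exists_planarMatching_of_hasChain eU eV hm le_rfl le_rfl hc
    have := h M (by simpa using hM)
    omega
  · intro h M hM
    by_contra! hlt
    exact h (hasChain_of_planarMatching eU eV hm (by simpa using hM) hlt
      fun e _ => ⟨(eU e.1).2, (eV e.2).2⟩)

end Matchings

theorem exists_bijective_graph_boundedMatrix {U V : Type*} [LinearOrder U] [Fintype U]
    [LinearOrder V] [Fintype V] (n r d : ℕ) (hU : Fintype.card U = n)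
    (hV : Fintype.card V = n) :
    ∃ f : regularGraphs U V r d → {m | IsBoundedMatrix n r d m}, Function.Bijective f := by
  let eU : U ≃o Fin n := (Fintype.orderIsoFinOfCardEq U hU).symm
  let eV : V ≃o Fin n := (Fintype.orderIsoFinOfCardEq V hV).symm
  have hrow : ∀ {G : BipMultigraph U V} {m : ℕ → ℕ → ℕ},
      (∀ u v, m (eU u) (eV v) = G.mult u v) → ∀ u,
        ∑ j ∈ Finset.range n, m (eU u) j = ∑ v, G.mult u v := by
    intro G m hm u
    rw [Finset.sum_range, ← eV.toEquiv.sum_comp]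
    exact Finset.sum_congr rfl fun v _ => hm u v
  have hcol : ∀ {G : BipMultigraph U V} {m : ℕ → ℕ → ℕ},
      (∀ u v, m (eU u) (eV v) = G.mult u v) → ∀ v,
        ∑ i ∈ Finset.range n, m i (eV v) = ∑ u, G.mult u v := by
    intro G m hm v
    rw [Finset.sum_range, ← eU.toEquiv.sum_comp]
    exact Finset.sum_congr rfl fun u _ => hm u v
  refine exists_bijective_of_rel _ _
    (fun G m => ∀ u v, m (eU u) (eV v) = G.mult u v) ?_ ?_ ?_ ?_
  · intro G hG
    let m : ℕ → ℕ → ℕ := fun i j =>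
      if h : i < n ∧ j < n then G.mult (eU.symm ⟨i, h.1⟩) (eV.symm ⟨j, h.2⟩) else 0
    have hm : ∀ u v, m (eU u) (eV v) = G.mult u v := by
      intro u v
      simp [m]
    refine ⟨m, ⟨fun i j hij => dif_neg (by omega), fun i hi => ?_, fun j hj => ?_,
      (largestPlanar_le_iff eU eV hm d).1 hG.2⟩, hm⟩
    · have h := hrow hm (eU.symm ⟨i, hi⟩)
      rwa [OrderIso.apply_symm_apply, hG.1.1] at h
    · have h := hcol hm (eV.symm ⟨j, hj⟩)
      rwa [OrderIso.apply_symm_apply, hG.1.2] at h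
  · intro m hm
    have hm' : ∀ u v, m (eU u) (eV v) =
        (⟨fun u v => m (eU u) (eV v)⟩ : BipMultigraph U V).mult u v := fun _ _ => rfl
    refine ⟨⟨fun u v => m (eU u) (eV v)⟩, ⟨⟨fun u => ?_, fun v => ?_⟩,
      (largestPlanar_le_iff eU eV hm' d).2 hm.not_hasChain⟩, hm'⟩
    · rw [← hrow hm']
      exact hm.sum_row _ (eU u).2
    · rw [← hcol hm']
      exact hm.sum_col _ (eV v).2
  · intro G _ m hm m' hm' h h'
    funext i j
    by_cases hij : i < n ∧ j < n
    · have h1 := h (eU.symm ⟨i, hij.1⟩) (eV.symm ⟨j, hij.2⟩)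
      have h2 := h' (eU.symm ⟨i, hij.1⟩) (eV.symm ⟨j, hij.2⟩)
      simp only [OrderIso.apply_symm_apply] at h1 h2
      rw [h1, h2]
    · rw [hm.outside i j (by omega), hm'.outside i j (by omega)]
  · intro m _ G _ G' _ h h'
    ext u v
    rw [← h, ← h']

/-! ### Lattice words and tableaux -/

/-- The number of occurrences of the letter `i` among the first `t` letters of the word `a`. -/
def prefixCount {d m : ℕ} (a : Fin m → Fin d) (t i : ℕ) : ℕ :=
  (Finset.univ.filter fun s : Fin m => (s : ℕ) < t ∧ (a s : ℕ) = i).card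

section PrefixCount

variable {d m : ℕ} (a : Fin m → Fin d)

theorem prefixCount_zero : prefixCount a 0 = 0 := by
  funext i
  simp [prefixCount]

theorem prefixCount_succ (s : Fin m) (i : ℕ) :
    prefixCount a (s + 1) i = prefixCount a s i + if (a s : ℕ) = i then 1 else 0 := by
  unfold prefixCount
  split_ifs with h
  · rw [← Finset.card_insert_of_notMem (a := s) (by simp)]
    congr 1
    ext x
    simp only [Finset.mem_filter, Finset.mem_univ, true_and, Finset.mem_insert, Fin.ext_iff]
    constructor
    · rintro ⟨h1, h2⟩
      rcases Nat.lt_succ_iff_lt_or_eq.1 h1 with h3 | h3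
      · exact Or.inr ⟨h3, h2⟩
      · exact Or.inl h3
    · rintro (h1 | ⟨h1, h2⟩)
      · obtain rfl := Fin.ext h1
        exact ⟨Nat.lt_succ_self _, h⟩
      · exact ⟨by omega, h2⟩
  · rw [add_zero]
    congr 1
    ext x
    simp only [Finset.mem_filter, Finset.mem_univ, true_and]
    constructor
    · rintro ⟨h1, h2⟩
      refine ⟨lt_of_le_of_ne (by omega) fun h3 => h ?_, h2⟩
      obtain rfl := Fin.ext h3
      exact h2
    · exact fun ⟨h1, h2⟩ => ⟨by omega, h2⟩

theorem prefixCount_of_le {t : ℕ} (ht : m ≤ t) : prefixCount a t = prefixCount a m := by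
  funext i
  unfold prefixCount
  congr 1
  ext x
  simp [x.2.trans_le ht]

theorem prefixCount_mono {s t : ℕ} (h : s ≤ t) (i : ℕ) :
    prefixCount a s i ≤ prefixCount a t i := by
  refine Finset.card_le_card fun x hx => ?_
  simp only [Finset.mem_filter, Finset.mem_univ, true_and] at hx ⊢
  exact ⟨by omega, hx.2⟩

theorem prefixCount_eq_zero (t : ℕ) {i : ℕ} (hi : d ≤ i) : prefixCount a t i = 0 := by
  simp only [prefixCount, Finset.card_eq_zero, Finset.filter_eq_empty_iff, Finset.mem_univ,
    true_implies]
  intro x hx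
  have := (a x).2
  omega

theorem sum_prefixCount {t : ℕ} (ht : t ≤ m) :
    ∑ i ∈ Finset.range d, prefixCount a t i = t := by
  induction t with
  | zero => simp [prefixCount_zero]
  | succ t ih =>
    have h := prefixCount_succ a ⟨t, ht⟩
    dsimp only at h
    simp only [h, Finset.sum_add_distrib, ih (by omega), Finset.sum_ite_eq, Finset.mem_range,
      (a ⟨t, ht⟩).2, if_true]

theorem prefixCount_self (i : Fin d) :
    prefixCount a m i = (Finset.univ.filter fun s => a s = i).card := by
  simp [prefixCount, Fin.ext_iff]

/-- The letters of `a` other than the first `m - t` are the first `t` letters of the reversed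
word. -/
theorem prefixCount_rev {t : ℕ} (ht : t ≤ m) (i : ℕ) :
    prefixCount (a ∘ Fin.rev) t i + prefixCount a (m - t) i = prefixCount a m i := by
  induction t with
  | zero => simp [prefixCount_zero]
  | succ t ih =>
    have h1 := prefixCount_succ (a ∘ Fin.rev) ⟨t, ht⟩ i
    have h2 := prefixCount_succ a (Fin.rev ⟨t, ht⟩) i
    simp only [Fin.val_rev, Function.comp_apply] at h1 h2
    have h3 := ih (by omega)
    rw [show m - t = m - (t + 1) + 1 by omega] at h3
    omega

end PrefixCount

/-- The positions of a letter in a weakly decreasing word form the interval determined by the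
numbers of occurrences of the letters, so these numbers determine the word. -/
theorem mem_interval_of_antitone {r d : ℕ} {g : Fin r → Fin d} (hg : Antitone g) (k : Fin r) :
    above (fun v : Fin d => prefixCount g r v) (g k) ≤ k ∧
      (k : ℕ) < above (fun v : Fin d => prefixCount g r v) (g k) + prefixCount g r (g k) := by
  have key : ∀ s : Finset (Fin d), ∑ v ∈ s, prefixCount g r v =
      (Finset.univ.filter fun j => g j ∈ s).card := by
    intro s
    rw [Finset.card_eq_sum_card_fiberwise (f := g) (t := s) fun j hj => by simpa using hj]
    refine Finset.sum_congr rfl fun v hv => ?_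
    rw [prefixCount_self, Finset.filter_filter]
    congr 1
    ext j
    simp only [Finset.mem_filter, Finset.mem_univ, true_and]
    exact ⟨fun h => ⟨h ▸ hv, h⟩, fun h => h.2⟩
  constructor
  · rw [above, key]
    calc _ ≤ (Finset.Iio k).card := Finset.card_le_card fun j hj => by
          simp only [Finset.mem_filter, Finset.mem_univ, true_and] at hj
          exact Finset.mem_Iio.2 (lt_of_not_ge fun h => absurd (hg h) (not_le.2 hj))
      _ = k := Fin.card_Iio k
  · have h := above_add_self (fun v : Fin d => prefixCount g r v) (g k)
    rw [key] at h
    rw [h]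
    calc (k : ℕ) < (Finset.Iic k).card := by simp
      _ ≤ _ := Finset.card_le_card fun j hj => by
          simp only [Finset.mem_filter, Finset.mem_univ, true_and]
          exact hg (Finset.mem_Iic.1 hj)

theorem eq_of_antitone_of_prefixCount_eq {r d : ℕ} {g g' : Fin r → Fin d} (hg : Antitone g)
    (hg' : Antitone g') (h : ∀ i, prefixCount g r i = prefixCount g' r i) : g = g' := by
  funext k
  refine eq_of_mem_interval (mem_interval_of_antitone hg k) ?_
  have h1 := mem_interval_of_antitone hg' k
  simpa only [h] using h1

theorem exists_antitone_prefixCount {r d : ℕ} (c : ℕ → ℕ) (hc : ∑ i ∈ Finset.range d, c i = r) :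
    ∃ g : Fin r → Fin d, Antitone g ∧ ∀ i, i < d → prefixCount g r i = c i := by
  rw [Finset.sum_range] at hc
  choose g hg using fun k : Fin r =>
    exists_mem_interval (c := fun v : Fin d => c v) (k := k) (by rw [hc]; exact k.2)
  refine ⟨g, fun j k hjk => le_of_not_gt fun hlt => ?_, fun i hi => ?_⟩
  · have h1 := above_add_self_le_above (fun v : Fin d => c v) hlt
    have h2 := hg j
    have h3 := hg k
    have h4 : (j : ℕ) ≤ k := hjk
    omega
  · rw [prefixCount_self g ⟨i, hi⟩, ← card_interval hc ⟨i, hi⟩]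
    congr 1
    ext k
    simp only [Finset.mem_filter, Finset.mem_univ, true_and]
    constructor
    · intro h
      have h1 := hg k
      rw [h] at h1
      exact h1
    · exact fun h => eq_of_mem_interval (hg k) h

theorem blockDecreasing_iff {d n r : ℕ} {a : Fin (n * r) → Fin d} :
    BlockDecreasing a ↔ ∀ u, Antitone fun i => a (finProdFinEquiv (u, i)) := by
  constructor
  · intro h u
    cases r with
    | zero => exact fun i => i.elim0
    | succ r =>
      rw [Fin.antitone_iff_succ_le]
      exact fun i => h u i.castSucc (by simp)
  · exact fun h u i hi => h u (Fin.le_def.2 (Nat.le_succ _))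

theorem prefixCount_block {d n r : ℕ} (a : Fin (n * r) → Fin d) (k : Fin n) {s : ℕ}
    (hs : s ≤ r) (i : ℕ) : prefixCount a (k * r + s) i =
      prefixCount a (k * r) i + prefixCount (fun j => a (finProdFinEquiv (k, j))) s i := by
  induction s with
  | zero => simp [prefixCount_zero]
  | succ s ih =>
    have h1 := prefixCount_succ a (finProdFinEquiv (k, ⟨s, hs⟩)) i
    have h2 := prefixCount_succ (fun j => a (finProdFinEquiv (k, j))) ⟨s, hs⟩ i
    have h3 : ((finProdFinEquiv (k, (⟨s, hs⟩ : Fin r)) : Fin (n * r)) : ℕ) = k * r + s := by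
      rw [finProdFinEquiv_apply_val, mul_comm, add_comm]
    rw [h3] at h1
    dsimp only at h2
    rw [← add_assoc, h1, h2, ih (by omega), add_assoc]

/-- Words of `n` weakly decreasing blocks of length `r` in which every prefix contains each letter
at least as often as every larger letter. -/
structure IsLatticeWord (n r d : ℕ) (a : Fin (n * r) → Fin d) : Prop where
  blockDecreasing : BlockDecreasing a
  antitone : ∀ t, Antitone (prefixCount a t)

/-- For the strip condition in row `i + 1`, the chamber condition is used at the moment when a block
has placed all its letters greater than `i` and none of its letters `i`. -/
theorem IsLatticeWord.interlace {n r d : ℕ} {a : Fin (n * r) → Fin d}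
    (h : IsLatticeWord n r d a) (k : Fin n) :
    Interlace (prefixCount a (k * r)) (prefixCount a ((k + 1) * r)) := by
  intro i
  have hg := blockDecreasing_iff.1 h.blockDecreasing k
  set g : Fin r → Fin d := fun j => a (finProdFinEquiv (k, j)) with hgdef
  refine ⟨prefixCount_mono a (Nat.mul_le_mul_right r (Nat.le_succ k)) i, ?_⟩
  -- The block is cut after its last letter greater than `i`.
  obtain ⟨s, hs, hsg⟩ : ∃ s ≤ r, ∀ j : Fin r, (j : ℕ) < s ↔ i + 1 ≤ (g j : ℕ) := by
    by_cases hex : ∃ s, ∃ hs : s < r, (g ⟨s, hs⟩ : ℕ) ≤ i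
    · classical
      obtain ⟨hr, hle⟩ := Nat.find_spec hex
      refine ⟨Nat.find hex, hr.le, fun j => ⟨fun hj => ?_, fun hj => ?_⟩⟩
      · have := Nat.find_min hex hj
        push Not at this
        exact this j.2
      · by_contra! hlt
        have h1 : g j ≤ g ⟨Nat.find hex, hr⟩ := hg hlt
        have h2 : (g j : ℕ) ≤ g ⟨Nat.find hex, hr⟩ := h1
        omega
    · push Not at hex
      exact ⟨r, le_rfl, fun j => ⟨fun _ => hex j j.2, fun _ => j.2⟩⟩
  have h1 := prefixCount_block a k hs i
  have h2 := prefixCount_block a k hs (i + 1)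
  have h3 := prefixCount_block a k le_rfl (i + 1)
  have h4 := h.antitone (k * r + s) (show i ≤ i + 1 by omega)
  have h5 : prefixCount g s i = 0 := by
    simp only [prefixCount, Finset.card_eq_zero, Finset.filter_eq_empty_iff, Finset.mem_univ,
      true_implies, hsg]
    omega
  have h6 : prefixCount g s (i + 1) = prefixCount g r (i + 1) := by
    unfold prefixCount
    congr 1
    ext j
    simp only [Finset.mem_filter, Finset.mem_univ, true_and, hsg, j.2]
    omega
  rw [← hgdef] at h1 h2 h3
  rw [Nat.succ_mul]
  omega

theorem IsLatticeWord.isTableau {n r d : ℕ} {a : Fin (n * r) → Fin d}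
    (h : IsLatticeWord n r d a) : IsTableau n r d fun k => prefixCount a (k * r) where
  zero := by rw [Nat.zero_mul, prefixCount_zero]
  interlace k hk := h.interlace ⟨k, hk⟩
  eq_last k hk := prefixCount_of_le a (Nat.mul_le_mul_right r hk)
  rows k i hi := prefixCount_eq_zero a _ hi
  sum_eq k hk := sum_prefixCount a (Nat.mul_le_mul_right r hk)

theorem IsLatticeWord.ext {n r d : ℕ} {a a' : Fin (n * r) → Fin d}
    (h : IsLatticeWord n r d a) (h' : IsLatticeWord n r d a')
    (heq : ∀ k, prefixCount a (k * r) = prefixCount a' (k * r)) : a = a' := by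
  have key : ∀ k : Fin n, (fun j => a (finProdFinEquiv (k, j))) =
      fun j => a' (finProdFinEquiv (k, j)) := by
    intro k
    refine eq_of_antitone_of_prefixCount_eq (blockDecreasing_iff.1 h.blockDecreasing k)
      (blockDecreasing_iff.1 h'.blockDecreasing k) fun i => ?_
    have h1 := prefixCount_block a k le_rfl i
    have h2 := prefixCount_block a' k le_rfl i
    rw [← Nat.succ_mul] at h1 h2
    rw [heq, heq] at h1
    omega
  funext s
  obtain ⟨⟨k, j⟩, rfl⟩ := finProdFinEquiv.surjective s
  exact congrFun (key k) j

theorem IsTableau.antitone {n r d : ℕ} {p : ℕ → ℕ → ℕ} (h : IsTableau n r d p) (k : ℕ) :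
    Antitone (p k) := by
  rcases Nat.lt_or_ge k n with hk | hk
  · exact (h.interlace k hk).antitone_left
  · rw [h.eq_last k hk]
    cases n with
    | zero => rw [h.zero]; exact antitone_const
    | succ n => exact (h.interlace n (Nat.lt_succ_self n)).antitone_right

theorem IsTableau.exists_latticeWord {n r d : ℕ} {p : ℕ → ℕ → ℕ} (h : IsTableau n r d p) :
    ∃ a : Fin (n * r) → Fin d, IsLatticeWord n r d a ∧ ∀ k, prefixCount a (k * r) = p k := by
  have hsum : ∀ k : Fin n, ∑ i ∈ Finset.range d, (p (k + 1) i - p k i) = r := by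
    intro k
    have h1 := h.sum_eq (k + 1) k.2
    have h2 := h.sum_eq k k.2.le
    rw [Finset.sum_tsub_distrib _ fun i _ => (h.interlace k k.2 i).1, h1, h2, Nat.succ_mul,
      Nat.add_sub_cancel_left]
  choose g hg hcount using fun k : Fin n => exists_antitone_prefixCount _ (hsum k)
  let a : Fin (n * r) → Fin d := fun s => g (finProdFinEquiv.symm s).1 (finProdFinEquiv.symm s).2
  have ha : ∀ k : Fin n, (fun j => a (finProdFinEquiv (k, j))) = g k := by
    intro k
    funext j
    simp only [a, Equiv.symm_apply_apply]
  have hp : ∀ k, k ≤ n → prefixCount a (k * r) = p k := by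
    intro k hk
    induction k with
    | zero => rw [Nat.zero_mul, prefixCount_zero, h.zero]
    | succ k ih =>
      funext i
      rcases Nat.lt_or_ge i d with hi | hi
      · have h1 := prefixCount_block a ⟨k, hk⟩ le_rfl i
        have h2 := (h.interlace k hk i).1
        rw [ha, hcount _ i hi, ← Nat.succ_mul] at h1
        dsimp only at h1
        rw [ih (by omega)] at h1
        rw [Nat.succ_eq_add_one] at h1
        omega
      · rw [prefixCount_eq_zero a _ hi, h.rows _ _ hi]
  have hp' : ∀ k, prefixCount a (k * r) = p k := fun k => by
    rcases Nat.lt_or_ge k n with hk | hk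
    · exact hp k hk.le
    · rw [h.eq_last k hk, ← hp n le_rfl, prefixCount_of_le a (Nat.mul_le_mul_right r hk)]
  refine ⟨a, ⟨blockDecreasing_iff.2 fun k => by rw [ha]; exact hg k, fun t => ?_⟩, hp'⟩
  rcases Nat.lt_or_ge t (n * r) with ht | ht
  · have hr : 0 < r := Nat.pos_of_ne_zero fun h0 => by simp [h0] at ht
    have hk : t / r < n := Nat.div_lt_of_lt_mul (by rwa [mul_comm])
    have ht1 : t / r * r ≤ t := Nat.div_mul_le_self t r
    have ht2 : t ≤ (t / r + 1) * r := by
      have := Nat.div_add_mod t r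
      have := Nat.mod_lt t hr
      rw [Nat.succ_mul, mul_comm]
      omega
    -- The `t`-th shape lies between `p k` and `p (k + 1)`, where `k = t / r`.
    refine antitone_nat_of_succ_le fun i => ?_
    have h1 := prefixCount_mono a ht1 i
    have h2 := prefixCount_mono a ht2 (i + 1)
    have h3 := (h.interlace _ hk i).2
    rw [hp'] at h1 h2
    omega
  · rw [prefixCount_of_le a ht, hp']
    exact h.antitone n

theorem exists_bijective_tableau_latticeWord (n r d : ℕ) :
    ∃ f : {pq : (ℕ → ℕ → ℕ) × (ℕ → ℕ → ℕ) |
          IsTableau n r d pq.1 ∧ IsTableau n r d pq.2 ∧ pq.1 n = pq.2 n} →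
        {ab : (Fin (n * r) → Fin d) × (Fin (n * r) → Fin d) |
          IsLatticeWord n r d ab.1 ∧ IsLatticeWord n r d ab.2 ∧
            prefixCount ab.1 (n * r) = prefixCount ab.2 (n * r)},
      Function.Bijective f := by
  refine exists_bijective_of_rel _ _ (fun pq ab =>
    ∀ k, prefixCount ab.1 (k * r) = pq.1 k ∧ prefixCount ab.2 (k * r) = pq.2 k) ?_ ?_ ?_ ?_
  · rintro ⟨p, q⟩ ⟨hp, hq, hpq⟩
    obtain ⟨a, ha, hap⟩ := hp.exists_latticeWord
    obtain ⟨b, hb, hbq⟩ := hq.exists_latticeWord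
    exact ⟨(a, b), ⟨ha, hb, (hap n).trans (hpq.trans (hbq n).symm)⟩, fun k => ⟨hap k, hbq k⟩⟩
  · rintro ⟨a, b⟩ ⟨ha, hb, hab⟩
    exact ⟨(_, _), ⟨ha.isTableau, hb.isTableau, hab⟩, fun k => ⟨rfl, rfl⟩⟩
  · rintro ⟨p, q⟩ - ⟨a, b⟩ ⟨ha, hb, -⟩ ⟨a', b'⟩ ⟨ha', hb', -⟩ h h'
    exact Prod.ext (ha.ext ha' fun k => (h k).1.trans (h' k).1.symm)
      (hb.ext hb' fun k => (h k).2.trans (h' k).2.symm)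
  · rintro ⟨a, b⟩ - ⟨p, q⟩ - ⟨p', q'⟩ - h h'
    exact Prod.ext (funext fun k => (h k).1.symm.trans (h' k).1)
      (funext fun k => (h k).2.symm.trans (h' k).2)

/-! ### Lattice words and walks -/

/-- The walk `a_1 ⋯ a_m | b_1 ⋯ b_m`. For `t ≤ m` the truncated difference `t - m` is zero, and
for `t ≥ m` all of `a` lies in its prefix of length `t`. -/
def stepWalk {d m : ℕ} (a b : Fin m → Fin d) (t : Fin (m + m + 1)) (i : Fin d) : ℤ :=
  (prefixCount a t i : ℤ) - prefixCount b (t - m) i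

theorem stepWalk_zero {d m : ℕ} (a b : Fin m → Fin d) : stepWalk a b 0 = 0 := by
  funext i
  simp [stepWalk, prefixCount_zero]

theorem hasSteps_stepWalk {d m : ℕ} (a b : Fin m → Fin d) : HasSteps (stepWalk a b) a b := by
  constructor
  · intro s
    funext i
    have h := prefixCount_succ a s i
    simp only [stepWalk, Pi.add_apply, Pi.single_apply, Fin.val_succ, Fin.val_castSucc,
      Fin.val_castAdd, h, Nat.sub_eq_zero_of_le s.2, Nat.sub_eq_zero_of_le s.2.le,
      prefixCount_zero, Fin.ext_iff, eq_comm (a := (i : ℕ))]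
    push_cast
    simp
  · intro s
    funext i
    have h := prefixCount_succ b s i
    simp only [stepWalk, Pi.sub_apply, Pi.single_apply, Fin.val_succ, Fin.val_castSucc,
      Fin.val_natAdd, add_assoc, Nat.add_sub_cancel_left, h, Fin.ext_iff,
      eq_comm (a := (i : ℕ)), prefixCount_of_le a (Nat.le_add_right m _)]
    push_cast
    ring

theorem HasSteps.unique_walk {d m : ℕ} {a b : Fin m → Fin d}
    {w w' : Fin (m + m + 1) → Fin d → ℤ} (h : HasSteps w a b) (h' : HasSteps w' a b)
    (h0 : w 0 = w' 0) : w = w' := by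
  funext t
  induction t using Fin.induction with
  | zero => exact h0
  | succ t ih =>
    induction t using Fin.addCases with
    | left s => rw [h.1, h'.1, ih]
    | right s => rw [h.2, h'.2, ih]

theorem HasSteps.unique_steps {d m : ℕ} {a b a' b' : Fin m → Fin d}
    {w : Fin (m + m + 1) → Fin d → ℤ} (h : HasSteps w a b) (h' : HasSteps w a' b') :
    a = a' ∧ b = b' := by
  have key : ∀ x y : Fin d, (Pi.single x 1 : Fin d → ℤ) = Pi.single y 1 → x = y := by
    intro x y hxy
    by_contra hne
    have := congrFun hxy x
    simp [Pi.single_eq_of_ne hne] at this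
  exact ⟨funext fun s => key _ _ (add_left_cancel ((h.1 s).symm.trans (h'.1 s))),
    funext fun s => key _ _ (sub_right_injective ((h.2 s).symm.trans (h'.2 s)))⟩

theorem HasSteps.mem_walks {d m : ℕ} {a b : Fin m → Fin d} {w : Fin (m + m + 1) → Fin d → ℤ}
    {p : Fin d → ℤ} (h : HasSteps w a b) (h0 : w 0 = 0) (hp : w (Fin.last (m + m)) = p) :
    w ∈ walks d (m + m) p := by
  have key : ∀ x : Fin d, ∑ k, |(Pi.single x 1 : Fin d → ℤ) k| = 1 := by
    intro x
    rw [Finset.sum_eq_single x]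
    · simp
    · intro y _ hy
      simp [Pi.single_eq_of_ne hy]
    · simp
  refine ⟨fun t => ?_, h0, hp⟩
  induction t using Fin.addCases with
  | left s => simp only [h.1, Pi.add_apply, add_sub_cancel_left, key]
  | right s => simp only [h.2, Pi.sub_apply, sub_sub_cancel_left, abs_neg, key]

theorem stepWalk_last {d m : ℕ} (a b : Fin m → Fin d) :
    stepWalk a b (Fin.last (m + m)) = 0 ↔ prefixCount a m = prefixCount b m := by
  have h : ∀ i, stepWalk a b (Fin.last (m + m)) i =
      (prefixCount a m i : ℤ) - prefixCount b m i := by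
    intro i
    rw [stepWalk, Fin.val_last, prefixCount_of_le a (Nat.le_add_left m m), Nat.add_sub_cancel]
  constructor
  · intro h0
    funext i
    rcases Nat.lt_or_ge i d with hi | hi
    · have h1 := h ⟨i, hi⟩
      rw [h0, Pi.zero_apply] at h1
      dsimp only at h1
      omega
    · rw [prefixCount_eq_zero a _ hi, prefixCount_eq_zero b _ hi]
  · intro hab
    funext i
    rw [h, hab, sub_self, Pi.zero_apply]

theorem antitone_prefixCount_iff {d m : ℕ} (a : Fin m → Fin d) (t : ℕ) :
    Antitone (prefixCount a t) ↔
      ∀ i j : Fin d, i ≤ j → prefixCount a t j ≤ prefixCount a t i := by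
  refine ⟨fun h i j hij => h hij, fun h i j hij => ?_⟩
  rcases Nat.lt_or_ge j d with hj | hj
  · exact h ⟨i, by omega⟩ ⟨j, hj⟩ hij
  · rw [prefixCount_eq_zero a t hj]
    exact Nat.zero_le _

/-- Seen from its end point, the second half of the walk `a_1 ⋯ a_m | b_m ⋯ b_1` is the walk with
the positive steps `b_1, …, b_m`. -/
theorem staysInChamber_iff {d m : ℕ} {a b : Fin m → Fin d}
    (hab : prefixCount a m = prefixCount b m) :
    StaysInChamber (stepWalk a (b ∘ Fin.rev)) ↔
      (∀ t, Antitone (prefixCount a t)) ∧ ∀ t, Antitone (prefixCount b t) := by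
  have h1 : ∀ (t : ℕ) (ht : t ≤ m) (i : Fin d),
      stepWalk a (b ∘ Fin.rev) ⟨t, by omega⟩ i = prefixCount a t i := by
    intro t ht i
    rw [stepWalk, Nat.sub_eq_zero_of_le ht, prefixCount_zero]
    simp
  have h2 : ∀ (t : ℕ) (ht : t ≤ m) (i : Fin d),
      stepWalk a (b ∘ Fin.rev) ⟨m + m - t, by omega⟩ i = prefixCount b t i := by
    intro t ht i
    have h3 := prefixCount_rev b (Nat.sub_le m t) i
    rw [Nat.sub_sub_self ht] at h3
    rw [stepWalk, prefixCount_of_le a (by dsimp only; omega), hab,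
      show m + m - t - m = m - t by omega]
    omega
  constructor
  · intro h
    have key : ∀ a : Fin m → Fin d, (∀ t ≤ m, Antitone (prefixCount a t)) →
        ∀ t, Antitone (prefixCount a t) := by
      intro a ha t
      rcases le_total t m with ht | ht
      · exact ha t ht
      · rw [prefixCount_of_le a ht]
        exact ha m le_rfl
    refine ⟨key a fun t ht => (antitone_prefixCount_iff a t).2 fun i j hij => ?_,
      key b fun t ht => (antitone_prefixCount_iff b t).2 fun i j hij => ?_⟩
    · have h3 := h ⟨t, by omega⟩ i j hij
      rw [h1 t ht, h1 t ht] at h3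
      omega
    · have h3 := h ⟨m + m - t, by omega⟩ i j hij
      rw [h2 t ht, h2 t ht] at h3
      omega
  · rintro ⟨ha, hb⟩ ⟨t, ht⟩ i j hij
    rcases le_total t m with htm | htm
    · rw [h1 t htm, h1 t htm]
      exact_mod_cast ha t hij
    · have h3 := h2 (m + m - t) (by omega)
      simp only [Nat.sub_sub_self (show t ≤ m + m by omega)] at h3
      rw [h3, h3]
      exact_mod_cast hb _ hij

theorem exists_bijective_latticeWord_walk (n r d : ℕ) :
    ∃ f : {ab : (Fin (n * r) → Fin d) × (Fin (n * r) → Fin d) |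
          IsLatticeWord n r d ab.1 ∧ IsLatticeWord n r d ab.2 ∧
            prefixCount ab.1 (n * r) = prefixCount ab.2 (n * r)} →
        {w : Fin (n * r + n * r + 1) → Fin d → ℤ |
          w ∈ reversedWalks d n r 0 ∧ StaysInChamber w},
      Function.Bijective f := by
  have hrev : ∀ b : Fin (n * r) → Fin d,
      prefixCount (b ∘ Fin.rev) (n * r) = prefixCount b (n * r) := by
    intro b
    funext i
    simpa [prefixCount_zero] using prefixCount_rev b le_rfl i
  refine exists_bijective_of_rel _ _
    (fun ab w => HasSteps w ab.1 (ab.2 ∘ Fin.rev)) ?_ ?_ ?_ ?_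
  · rintro ⟨a, b⟩ ⟨ha, hb, hab⟩
    have hs := hasSteps_stepWalk a b
    have hs' := hasSteps_stepWalk a (b ∘ Fin.rev)
    exact ⟨stepWalk a (b ∘ Fin.rev),
      ⟨⟨hs'.mem_walks (stepWalk_zero _ _) ((stepWalk_last _ _).2 (hab.trans (hrev b).symm)),
        stepWalk a b, ⟨hs.mem_walks (stepWalk_zero _ _) ((stepWalk_last _ _).2 hab),
          a, b, hs, ha.blockDecreasing, hb.blockDecreasing⟩, a, b, hs, hs'⟩,
        (staysInChamber_iff hab).2 ⟨ha.antitone, hb.antitone⟩⟩, hs'⟩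
  · rintro w ⟨⟨⟨-, h0, hlast⟩, v, ⟨-, a, b, hv, ha, hb⟩, a', b', hv', hw⟩, hch⟩
    obtain ⟨rfl, rfl⟩ := hv.unique_steps hv'
    obtain rfl : w = stepWalk a (b ∘ Fin.rev) :=
      hw.unique_walk (hasSteps_stepWalk _ _) (h0.trans (stepWalk_zero _ _).symm)
    have hab := ((stepWalk_last _ _).1 hlast).trans (hrev b)
    have h := (staysInChamber_iff hab).1 hch
    exact ⟨(a, b), ⟨⟨ha, h.1⟩, ⟨hb, h.2⟩, hab⟩, hw⟩
  · rintro ⟨a, b⟩ - w ⟨⟨⟨-, h0, -⟩, -⟩, -⟩ w' ⟨⟨⟨-, h0', -⟩, -⟩, -⟩ h h'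
    exact h.unique_walk h' (h0.trans h0'.symm)
  · rintro w - ⟨a, b⟩ - ⟨a', b'⟩ - h h'
    obtain ⟨h1, h2⟩ := h.unique_steps h'
    exact Prod.ext h1 (Fin.rev_surjective.injective_comp_right h2)

end PlanarMatching

theorem theorem6 {U V : Type*} [LinearOrder U] [Fintype U] [LinearOrder V] [Fintype V]
    (n r d : ℕ) (hU : Fintype.card U = n) (hV : Fintype.card V = n) :
    ∃ f : PlanarMatching.regularConfigurations U V r d →
        {w : Fin (n * r + n * r + 1) → Fin d → ℤ |
          w ∈ PlanarMatching.reversedWalks d n r 0 ∧ PlanarMatching.StaysInChamber w},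
      Function.Bijective f := by
  obtain ⟨f₁, h₁⟩ := PlanarMatching.exists_bijective_configuration_graph U V r d
  obtain ⟨f₂, h₂⟩ := PlanarMatching.exists_bijective_graph_boundedMatrix n r d hU hV
  obtain ⟨f₃, h₃⟩ := PlanarMatching.exists_bijective_boundedMatrix_tableau n r d
  obtain ⟨f₄, h₄⟩ := PlanarMatching.exists_bijective_tableau_latticeWord n r d
  obtain ⟨f₅, h₅⟩ := PlanarMatching.exists_bijective_latticeWord_walk n r d
  exact ⟨_, h₅.comp (h₄.comp (h₃.comp (h₂.comp h₁)))⟩
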